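/- \textbf{Setting.} Let $M\in\mathbb N$ and let $k_m$, $\alpha_{i,j}^m$, $\beta_{i,11}^m,\beta_{i,12}^m,\beta_{i,22}^m$ ($1\le m\le M$, $i,j\in\{1,2\}$) be real numbers such that $\alpha_{1,2}^m=\alpha_{2,1}^m$, $\beta_{1,22}^m=\beta_{2,12}^m$, $\beta_{1,12}^m=\beta_{2,11}^m$ for all $m$. (They are the coupling constants and the linear and quadratic Taylor coefficients at $0$ of the nonlinearities in the travelling wave equation of a two-dimensional FPU lattice.) Put $$c_1=\sum_m k_m^2\alpha_{1,1}^m,\quad c_2=\sum_m k_m^2\alpha_{1,2}^m,\quad c_3=\sum_m k_m^2\alpha_{2,2}^m,\qquad \sigma_0=\frac{c_1+c_3+\sqrt{(c_1-c_3)^2+4c_2^2}}{2},\qquad \lambda=\frac{c_2}{\sigma_0-c_3},$$ so that $\sigma_0$ is the larger root of $(c_1-\sigma)(c_3-\sigma)=c_2^2$, and $$a_1=\sum_m\tfrac{k_m^4}{12}\alpha_{1,1}^m,\quad a_2=\sum_m\tfrac{k_m^4}{12}\alpha_{1,2}^m,\quad b_1=\sum_m\tfrac{k_m^4}{12}\alpha_{2,2}^m,\quad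 b_2=\sum_m\tfrac{k_m^4}{12}\alpha_{2,1}^m,$$ $$a_3=\sum_m\tfrac{k_m^3}{2}\beta_{1,11}^m,\quad a_4=\sum_m\tfrac{k_m^3}{2}\beta_{1,22}^m,\quad a_5=\sum_m k_m^3\beta_{1,12}^m,\quad b_3=\sum_m\tfrac{k_m^3}{2}\beta_{2,22}^m,\quad b_4=\sum_m\tfrac{k_m^3}{2}\beta_{2,11}^m,\quad b_5=\sum_m k_m^3\beta_{2,12}^m,$$ $$d_1=\frac{1+\lambda^2}{(a_1+\lambda a_2)+\lambda(b_2+\lambda b_1)},\qquad d_2=\frac{(a_3+\lambda^2a_4+\lambda a_5)+\lambda(\lambda b_5+\lambda^2b_3+b_4)}{(a_1+\lambda a_2)+\lambda(b_2+\lambda b_1)}.$$ With $\operatorname{sinc}(x)=\sin(x)/x$, $\operatorname{sinc}(0)=1$, let $S_k(z)=1-\operatorname{sinc}^2(kz/2)$ and $$T(z)=\big(2\sigma_0-(c_1+c_3)\big)\Big(\sum_m k_m^2\big((\sigma_0-c_3)\alpha_{1,1}^m+(\sigma_0-c_1)\alpha_{2,2}^m+2c_2\alpha_{1,2}^m\big)S_{k_m}(z)$$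 $$\qquad+\Big(\sum_m k_m^2\alpha_{1,1}^mS_{k_m}(z)\Big)\Big(\sum_m k_m^2\alpha_{2,2}^mS_{k_m}(z)\Big)-\Big(\sum_m k_m^2\alpha_{1,2}^mS_{k_m}(z)\Big)^2\Big).$$ \textbf{Assumptions.} $\sigma_0>0$, $c_2\neq0$, $d_1>0$, $d_2\neq0$ (in particular the denominator of $d_1$ and $d_2$ is nonzero), and there is $\delta_0>0$ with $T(z)\ge\delta_0\min\{|z|,2\}^2$ for all $z\in\mathbb R$. \textbf{Operators.} Let $W_*(\xi)=\frac{3d_1}{2d_2}\operatorname{sech}^2\big(\tfrac12\sqrt{d_1}\,\xi\big)$ and, for $\eta\ne0$, $(\mathcal A_\eta Y)(\xi)=\frac1\eta\int_{\xi-\eta/2}^{\xi+\eta/2}Y(t)\,dt$ (terms with $k_m=0$ below vanish). For $\epsilon>0$ let $\sigma_\epsilon=\sigma_0+\epsilon^2$ and define on $(L^2(\mathbb R))^2$ (real-valued functions) the operator $\mathcal L_\epsilon=\mathcal B_\epsilon-\mathcal M_\epsilon$, where $$\mathcal B_\epsilon=\begin{pmatrix}1&\lambda\\0&\epsilon^2\end{pmatrix}\mathcal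 B_\epsilon^{\rm can},\qquad (\mathcal B_\epsilon^{\rm can})_{ij}=\frac1{\epsilon^2}\Big(\sigma_\epsilon\delta_{ij}-\sum_m k_m^2\alpha_{i,j}^m\mathcal A_{k_m\epsilon}^2\Big),$$ $$(\mathcal M_\epsilon)_{1j}V=\sum_m\eta_{1,j}^m\,\mathcal A_{k_m\epsilon}\big((\mathcal A_{k_m\epsilon}W_*)\,\mathcal A_{k_m\epsilon}V\big),\qquad (\mathcal M_\epsilon)_{2j}V=\epsilon^2\sum_m\eta_{2,j}^m\,\mathcal A_{k_m\epsilon}\big((\mathcal A_{k_m\epsilon}W_*)\,\mathcal A_{k_m\epsilon}V\big),$$ with $\eta_{2,1}^m=k_m^3(\lambda\beta_{2,12}^m+\beta_{2,11}^m)$, $\eta_{2,2}^m=k_m^3(\lambda\beta_{2,22}^m+\beta_{2,12}^m)$, $\eta_{1,1}^m=k_m^3(\beta_{1,11}^m+\lambda\beta_{1,12}^m)+\lambda\eta_{2,1}^m$, $\eta_{1,2}^m=k_m^3(\lambda\beta_{1,22}^m+\beta_{1,12}^m)+\lambda\eta_{2,2}^m$. The operator $\mathcal L_\epsilon$ is bounded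 and maps $(L^2_{\rm even}(\mathbb R))^2$ into itself. \textbf{Theorem (invertibility of $\mathcal L_\epsilon$).} There exist $\epsilon_*>0$ and a constant $C$, not depending on $\epsilon$, such that for every $\epsilon\in(0,\epsilon_*)$ the operator $\mathcal L_\epsilon$ is invertible on $(L^2_{\rm even}(\mathbb R))^2$ with bounded inverse, and $\|\mathcal L_\epsilon^{-1}G\|_2\le C\|G\|_2$ for all $G\in(L^2_{\rm even}(\mathbb R))^2$. -/

import Mathlib

open MeasureTheory
open scoped ENNReal BoundedContinuousFunction

noncomputable section

namespace LatticeWave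

/-- The real Hilbert space `L²(ℝ)`. -/
abbrev L2 : Type := Lp ℝ 2 (volume : Measure ℝ)

/-- The real Hilbert space `(L²(ℝ))²`, with `‖V‖² = ‖V 0‖² + ‖V 1‖²`. -/
abbrev L2Pair : Type := PiLp 2 (fun _ : Fin 2 => L2)

/-! ### The averaging operator -/

/-- The moving average `ξ ↦ (1/η) ∫_{ξ-η/2}^{ξ+η/2} f(t) dt`. The interval integral is oriented, so
the expression is even in `η`. -/
def avg (η : ℝ) (f : ℝ → ℝ) (ξ : ℝ) : ℝ :=
  η⁻¹ * ∫ t in (ξ - η / 2)..(ξ + η / 2), f t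

theorem avg_eq {η : ℝ} (hη : η ≠ 0) (f : ℝ → ℝ) (ξ : ℝ) :
    avg η f ξ = ∫ s in (-(1 / 2) : ℝ)..(1 / 2), f (ξ + η * s) := by
  have h := intervalIntegral.integral_comp_add_mul (a := -(1 / 2)) (b := 1 / 2) f hη ξ
  rw [h, avg, smul_eq_mul]
  congr 2 <;> ring

theorem continuous_avg (η : ℝ) {f : ℝ → ℝ}
    (hf : ∀ a b, IntervalIntegrable f volume a b) : Continuous (avg η f) := by
  have h0 := intervalIntegral.continuous_primitive hf 0
  have h1 : avg η f = fun ξ => η⁻¹ *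
      ((∫ t in (0 : ℝ)..(ξ + η / 2), f t) - ∫ t in (0 : ℝ)..(ξ - η / 2), f t) := by
    funext ξ
    rw [avg, intervalIntegral.integral_interval_sub_left (hf _ _) (hf _ _)]
  rw [h1]
  exact continuous_const.mul ((h0.comp (continuous_id.add continuous_const)).sub
    (h0.comp (continuous_id.sub continuous_const)))

theorem intervalIntegrable_L2 {f : ℝ → ℝ} (hf : MemLp f 2 volume) (a b : ℝ) :
    IntervalIntegrable f volume a b :=
  ((hf.locallyIntegrable (by norm_num)).integrableOn_isCompact
    isCompact_uIcc).intervalIntegrable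

theorem eLpNorm_avg_le (η : ℝ) {f : ℝ → ℝ} (hf : StronglyMeasurable f) :
    eLpNorm (avg η f) 2 volume ≤ eLpNorm f 2 volume := by
  rcases eq_or_ne η 0 with rfl | hη
  · have : avg 0 f = 0 := by funext ξ; simp [avg]
    rw [this]; simp
  set ν : Measure ℝ := volume.restrict (Set.Ioc (-(1 / 2)) (1 / 2)) with hν
  have : IsProbabilityMeasure ν := ⟨by rw [hν]; simp; norm_num⟩
  have hpt : ∀ ξ, ‖avg η f ξ‖ₑ ^ (2 : ℝ) ≤ ∫⁻ s, ‖f (ξ + η * s)‖ₑ ^ (2 : ℝ) ∂ν := by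
    intro ξ
    have hm : StronglyMeasurable fun s => f (ξ + η * s) :=
      hf.comp_measurable (by fun_prop)
    have h1 : ‖avg η f ξ‖ₑ ≤ eLpNorm (fun s => f (ξ + η * s)) 1 ν := by
      rw [avg_eq hη, intervalIntegral.integral_of_le (by norm_num),
        eLpNorm_one_eq_lintegral_enorm]
      exact enorm_integral_le_lintegral_enorm _
    have h2 := h1.trans (eLpNorm_le_eLpNorm_of_exponent_le (μ := ν)
      (show (1 : ℝ≥0∞) ≤ 2 by norm_num) hm.aestronglyMeasurable)
    rw [eLpNorm_eq_lintegral_rpow_enorm_toReal (by norm_num) (by norm_num)] at h2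
    calc ‖avg η f ξ‖ₑ ^ (2 : ℝ) ≤ _ := ENNReal.rpow_le_rpow h2 (by norm_num)
      _ = _ := by
        rw [← ENNReal.rpow_mul]
        norm_num
  rw [eLpNorm_eq_lintegral_rpow_enorm_toReal (by norm_num) (by norm_num),
    eLpNorm_eq_lintegral_rpow_enorm_toReal (by norm_num) (by norm_num)]
  refine ENNReal.rpow_le_rpow ?_ (by norm_num)
  simp only [ENNReal.toReal_ofNat]
  have hmeas : Measurable f := hf.measurable
  calc ∫⁻ ξ, ‖avg η f ξ‖ₑ ^ (2 : ℝ) ≤ ∫⁻ ξ, ∫⁻ s, ‖f (ξ + η * s)‖ₑ ^ (2 : ℝ) ∂ν :=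
        lintegral_mono hpt
    _ = ∫⁻ s, (∫⁻ ξ, ‖f (ξ + η * s)‖ₑ ^ (2 : ℝ)) ∂ν :=
        lintegral_lintegral_swap (by fun_prop)
    _ = ∫⁻ _, (∫⁻ ξ, ‖f ξ‖ₑ ^ (2 : ℝ)) ∂ν := by
        refine lintegral_congr fun s => ?_
        exact lintegral_add_right_eq_self (fun ξ => ‖f ξ‖ₑ ^ (2 : ℝ)) (η * s)
    _ = ∫⁻ ξ, ‖f ξ‖ₑ ^ (2 : ℝ) := by simp

theorem memLp_avg (η : ℝ) (f : L2) : MemLp (avg η f) 2 volume :=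
  ⟨(continuous_avg η (intervalIntegrable_L2 (Lp.memLp f))).aestronglyMeasurable,
    (eLpNorm_avg_le η (Lp.stronglyMeasurable f)).trans_lt (Lp.memLp f).2⟩

theorem avg_congr (η : ℝ) {f g : ℝ → ℝ} (h : f =ᵐ[volume] g) : avg η f = avg η g := by
  funext ξ
  rw [avg, avg, intervalIntegral.integral_congr_ae (h.mono fun x hx _ => hx)]

/-- The averaging operator `𝒜_η` on `L²(ℝ)`. -/
def avgOp (η : ℝ) : L2 →L[ℝ] L2 :=
  LinearMap.mkContinuous
    { toFun := fun f => (memLp_avg η f).toLp (avg η f)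
      map_add' := fun f g => by
        rw [← MemLp.toLp_add]
        congr 1
        rw [avg_congr η (Lp.coeFn_add f g)]
        funext ξ
        simp only [avg, Pi.add_apply]
        rw [intervalIntegral.integral_add (intervalIntegrable_L2 (Lp.memLp f) _ _)
          (intervalIntegrable_L2 (Lp.memLp g) _ _), mul_add]
      map_smul' := fun c f => by
        rw [RingHom.id_apply, ← MemLp.toLp_const_smul]
        congr 1
        rw [avg_congr η (Lp.coeFn_smul c f)]
        funext ξ
        simp only [avg, Pi.smul_apply, smul_eq_mul]
        rw [intervalIntegral.integral_const_mul]
        ring }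
    1 (fun f => by
      rw [one_mul]
      simp only [LinearMap.coe_mk, AddHom.coe_mk]
      rw [Lp.norm_toLp, Lp.norm_def]
      exact ENNReal.toReal_mono (Lp.memLp f).2.ne
        (eLpNorm_avg_le η (Lp.stronglyMeasurable f)))

theorem avgOp_coeFn (η : ℝ) (f : L2) : avgOp η f =ᵐ[volume] avg η f :=
  (memLp_avg η f).coeFn_toLp

/-- The moving average of a bounded continuous function, again bounded and continuous. -/
def avgBCF (η : ℝ) (w : ℝ →ᵇ ℝ) : ℝ →ᵇ ℝ :=
  BoundedContinuousFunction.ofNormedAddCommGroup (avg η w)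
    (continuous_avg η fun a b => w.continuous.intervalIntegrable a b) ‖w‖ (fun ξ => by
      rcases eq_or_ne η 0 with rfl | hη
      · simp [avg]
      · rw [avg_eq hη]
        have h := intervalIntegral.norm_integral_le_of_norm_le_const
          (a := -(1 / 2)) (b := 1 / 2) (f := fun s => w (ξ + η * s)) (C := ‖w‖)
          (fun s _ => w.norm_coe_le_norm _)
        refine h.trans (le_of_eq ?_)
        norm_num)

/-! ### Multiplication by a bounded continuous function -/

theorem memLp_mul (w : ℝ →ᵇ ℝ) (f : L2) : MemLp (fun x => w x * f x) 2 volume :=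
  ((Lp.memLp f).norm.const_mul ‖w‖).mono
    (w.continuous.aestronglyMeasurable.mul (Lp.aestronglyMeasurable f))
    (Filter.Eventually.of_forall fun x => by
      rw [norm_mul, norm_mul, norm_norm, norm_norm]
      exact mul_le_mul_of_nonneg_right (w.norm_coe_le_norm x) (norm_nonneg _))

/-- The multiplication operator `f ↦ w f` on `L²(ℝ)`. -/
def mulOp (w : ℝ →ᵇ ℝ) : L2 →L[ℝ] L2 :=
  LinearMap.mkContinuous
    { toFun := fun f => (memLp_mul w f).toLp (fun x => w x * f x)
      map_add' := fun f g => by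
        rw [← MemLp.toLp_add]
        refine MemLp.toLp_congr _ _ ?_
        filter_upwards [Lp.coeFn_add f g] with x hx
        simp only [hx, Pi.add_apply]
        ring
      map_smul' := fun c f => by
        rw [RingHom.id_apply, ← MemLp.toLp_const_smul]
        refine MemLp.toLp_congr _ _ ?_
        filter_upwards [Lp.coeFn_smul c f] with x hx
        simp only [hx, Pi.smul_apply, smul_eq_mul]
        ring }
    ‖w‖ (fun f => by
      refine Lp.norm_le_mul_norm_of_ae_le_mul ?_
      filter_upwards [(memLp_mul w f).coeFn_toLp] with x hx
      simp only [LinearMap.coe_mk, AddHom.coe_mk]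
      rw [hx, norm_mul]
      exact mul_le_mul_of_nonneg_right (w.norm_coe_le_norm x) (norm_nonneg _))

theorem mulOp_coeFn (w : ℝ →ᵇ ℝ) (f : L2) : mulOp w f =ᵐ[volume] fun x => w x * f x :=
  (memLp_mul w f).coeFn_toLp

/-! ### Coefficients of the lattice -/

/-- The linear and quadratic data of the travelling wave equation with `M` coupling terms.
The component `i = 0, 1` of the `m`-th nonlinearity has the Taylor expansion
`α m i 0 * x₁ + α m i 1 * x₂ + (β₁₁ m i * x₁² + 2 * β₁₂ m i * x₁ * x₂ + β₂₂ m i * x₂²) / 2`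
up to higher order terms, and `k m` is the `m`-th coupling parameter. -/
structure Coeffs (M : ℕ) where
  k : Fin M → ℝ
  α : Fin M → Fin 2 → Fin 2 → ℝ
  β₁₁ : Fin M → Fin 2 → ℝ
  β₁₂ : Fin M → Fin 2 → ℝ
  β₂₂ : Fin M → Fin 2 → ℝ

namespace Coeffs

variable {M : ℕ} (P : Coeffs M)

/-- Symmetry of the Taylor coefficients (the nonlinearities are gradients). -/
structure Symmetric : Prop where
  α_symm : ∀ m, P.α m 0 1 = P.α m 1 0
  β_symm₁ : ∀ m, P.β₂₂ m 0 = P.β₁₂ m 1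
  β_symm₂ : ∀ m, P.β₁₂ m 0 = P.β₁₁ m 1

def c₁ : ℝ := ∑ m, P.k m ^ 2 * P.α m 0 0
def c₂ : ℝ := ∑ m, P.k m ^ 2 * P.α m 0 1
def c₃ : ℝ := ∑ m, P.k m ^ 2 * P.α m 1 1

/-- The larger solution `σ` of `(c₁ - σ) * (c₃ - σ) = c₂ ^ 2`. -/
def σ₀ : ℝ := ((P.c₁ + P.c₃) + √((P.c₁ - P.c₃) ^ 2 + 4 * P.c₂ ^ 2)) / 2

theorem σ₀_eq : (P.c₁ - P.σ₀) * (P.c₃ - P.σ₀) = P.c₂ ^ 2 := by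
  have h : √((P.c₁ - P.c₃) ^ 2 + 4 * P.c₂ ^ 2) ^ 2 = (P.c₁ - P.c₃) ^ 2 + 4 * P.c₂ ^ 2 :=
    Real.sq_sqrt (by positivity)
  rw [σ₀]
  linear_combination h / 4

/-- The ratio `λ` of the two components of the limiting wave. -/
def lam : ℝ := P.c₂ / (P.σ₀ - P.c₃)

def a₁ : ℝ := ∑ m, P.k m ^ 4 / 12 * P.α m 0 0
def a₂ : ℝ := ∑ m, P.k m ^ 4 / 12 * P.α m 0 1
def a₃ : ℝ := ∑ m, P.k m ^ 3 / 2 * P.β₁₁ m 0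
def a₄ : ℝ := ∑ m, P.k m ^ 3 / 2 * P.β₂₂ m 0
def a₅ : ℝ := ∑ m, P.k m ^ 3 * P.β₁₂ m 0
def b₁ : ℝ := ∑ m, P.k m ^ 4 / 12 * P.α m 1 1
def b₂ : ℝ := ∑ m, P.k m ^ 4 / 12 * P.α m 1 0
def b₃ : ℝ := ∑ m, P.k m ^ 3 / 2 * P.β₂₂ m 1
def b₄ : ℝ := ∑ m, P.k m ^ 3 / 2 * P.β₁₁ m 1
def b₅ : ℝ := ∑ m, P.k m ^ 3 * P.β₁₂ m 1

def d₁ : ℝ :=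
  (1 + P.lam ^ 2) / ((P.a₁ + P.lam * P.a₂) + P.lam * (P.b₂ + P.lam * P.b₁))

def d₂ : ℝ :=
  ((P.a₃ + P.lam ^ 2 * P.a₄ + P.lam * P.a₅)
      + P.lam * (P.lam * P.b₅ + P.lam ^ 2 * P.b₃ + P.b₄))
    / ((P.a₁ + P.lam * P.a₂) + P.lam * (P.b₂ + P.lam * P.b₁))

/-- Genericity and well-definedness of the KdV wave. -/
structure Generic : Prop where
  σ₀_pos : 0 < P.σ₀
  c₂_ne : P.c₂ ≠ 0
  d₁_pos : 0 < P.d₁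
  d₂_ne : P.d₂ ≠ 0

/-- `S_k(z) = 1 - sinc(k z / 2)²`. -/
def S (k z : ℝ) : ℝ := 1 - Real.sinc (k * z / 2) ^ 2

/-- `T(z)`: for `ε > 0`, the symbol at `z` of the determinant of `ℬ_ε` is
`2σ₀ - (c₁ + c₃) + ε² + T(ε z) / ((2σ₀ - (c₁ + c₃)) ε²) + ∑_m k_m² (α_{1,1}^m + α_{2,2}^m) S_{k_m}(ε z)`. -/
def T (z : ℝ) : ℝ :=
  (2 * P.σ₀ - (P.c₁ + P.c₃)) *
    ((∑ m, P.k m ^ 2 * ((P.σ₀ - P.c₃) * P.α m 0 0 + (P.σ₀ - P.c₁) * P.α m 1 1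
          + 2 * P.c₂ * P.α m 0 1) * S (P.k m) z)
      + (∑ m, P.k m ^ 2 * P.α m 0 0 * S (P.k m) z) * (∑ m, P.k m ^ 2 * P.α m 1 1 * S (P.k m) z)
      - (∑ m, P.k m ^ 2 * P.α m 0 1 * S (P.k m) z) ^ 2)

/-- The lower bound on the determinant symbol. -/
def InversionCondition : Prop :=
  ∃ δ₀ : ℝ, 0 < δ₀ ∧ ∀ z : ℝ, δ₀ * (min |z| 2) ^ 2 ≤ P.T z

/-- The KdV wave `W_*(ξ) = 3 d₁ / (2 d₂) * sech²(√d₁ ξ / 2)`. -/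
def kdvWave : ℝ →ᵇ ℝ :=
  BoundedContinuousFunction.ofNormedAddCommGroup
    (fun ξ => 3 * P.d₁ / (2 * P.d₂) * (1 / Real.cosh (1 / 2 * √P.d₁ * ξ)) ^ 2)
    (by
      refine continuous_const.mul ((continuous_const.div ?_ ?_).pow 2)
      · exact Real.continuous_cosh.comp (continuous_const.mul continuous_id)
      · exact fun ξ => (Real.cosh_pos _).ne')
    ‖3 * P.d₁ / (2 * P.d₂)‖
    (fun ξ => by
      have h1 := Real.one_le_cosh (1 / 2 * √P.d₁ * ξ)
      have h2 : (1 / Real.cosh (1 / 2 * √P.d₁ * ξ)) ^ 2 ≤ 1 :=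
        pow_le_one₀ (by positivity) (by rw [div_le_one (by positivity)]; exact h1)
      rw [norm_mul, norm_pow, Real.norm_eq_abs (1 / _), sq_abs]
      exact mul_le_of_le_one_right (norm_nonneg _) h2)

/-! ### The linearized operator -/

/-- The squared wave speed `σ_ε = σ₀ + ε²`. -/
def σ (ε : ℝ) : ℝ := P.σ₀ + ε ^ 2

/-- The `2 × 2` operator matrix
`ℬ_ε^can = ε⁻² (σ_ε δ_ij - ∑_m k_m² α_{i,j}^m 𝒜_{k_m ε}²)`. -/
def Bcan (ε : ℝ) : Matrix (Fin 2) (Fin 2) (L2 →L[ℝ] L2) := fun i j =>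
  (1 / ε ^ 2) • ((if i = j then P.σ ε else 0) • (1 : L2 →L[ℝ] L2)
    - ∑ m, (P.k m ^ 2 * P.α m i j) • avgOp (P.k m * ε) ^ 2)

/-- The scalar matrix `𝒯_ε`. -/
def Tmat (ε : ℝ) : Matrix (Fin 2) (Fin 2) ℝ := !![1, P.lam; 0, ε ^ 2]

/-- `ℬ_ε = 𝒯_ε · ℬ_ε^can`. -/
def B (ε : ℝ) : Matrix (Fin 2) (Fin 2) (L2 →L[ℝ] L2) :=
  (P.Tmat ε).map (algebraMap ℝ (L2 →L[ℝ] L2)) * P.Bcan ε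

/-- The coefficients `η_{i,j}^m`. -/
def etaCoeff (m : Fin M) : Matrix (Fin 2) (Fin 2) ℝ :=
  !![P.k m ^ 3 * ((P.β₁₁ m 0 + P.lam * P.β₁₂ m 0) + P.lam * (P.lam * P.β₁₂ m 1 + P.β₁₁ m 1)),
     P.k m ^ 3 * ((P.lam * P.β₂₂ m 0 + P.β₁₂ m 0) + P.lam * (P.lam * P.β₂₂ m 1 + P.β₁₂ m 1));
     P.k m ^ 3 * (P.lam * P.β₁₂ m 1 + P.β₁₁ m 1),
     P.k m ^ 3 * (P.lam * P.β₂₂ m 1 + P.β₁₂ m 1)]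

/-- The operator `f ↦ 𝒜_η ((𝒜_η W_*) (𝒜_η f))`. -/
def waveOp (η : ℝ) : L2 →L[ℝ] L2 :=
  avgOp η * mulOp (avgBCF η P.kdvWave) * avgOp η

/-- The operator matrix `ℳ_ε`: its second row carries the additional factor `ε²`. -/
def Mop (ε : ℝ) : Matrix (Fin 2) (Fin 2) (L2 →L[ℝ] L2) := fun i j =>
  (if i = 0 then 1 else ε ^ 2) • ∑ m, P.etaCoeff m i j • P.waveOp (P.k m * ε)

end Coeffs

/-- The operator on `(L²(ℝ))²` given by a `2 × 2` matrix of operators: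
`(X V)_i = ∑_j X_{ij} V_j`. -/
def matOp (X : Matrix (Fin 2) (Fin 2) (L2 →L[ℝ] L2)) : L2Pair →L[ℝ] L2Pair :=
  ((PiLp.continuousLinearEquiv 2 ℝ (fun _ : Fin 2 => L2)).symm :
      (Fin 2 → L2) →L[ℝ] L2Pair) ∘L
    ContinuousLinearMap.pi fun i => ∑ j, X i j ∘L PiLp.proj 2 (fun _ : Fin 2 => L2) j

theorem matOp_apply (X : Matrix (Fin 2) (Fin 2) (L2 →L[ℝ] L2)) (V : L2Pair) (i : Fin 2) :
    matOp X V i = ∑ j, X i j (V j) := by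
  simp [matOp]

/-- The linearized operator `ℒ_ε = ℬ_ε - ℳ_ε` on `(L²(ℝ))²`. -/
def Coeffs.Lop {M : ℕ} (P : Coeffs M) (ε : ℝ) : L2Pair →L[ℝ] L2Pair :=
  matOp (P.B ε - P.Mop ε)

/-! ### Even functions -/

/-- The subspace of even functions in `L²(ℝ)`. -/
def evenL2 : Submodule ℝ L2 where
  carrier := {f | ∀ᵐ x : ℝ, f (-x) = f x}
  zero_mem' := by
    have h := Lp.coeFn_zero ℝ 2 (volume : Measure ℝ)
    have h' := (Measure.measurePreserving_neg (volume : Measure ℝ)).quasiMeasurePreserving.ae h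
    filter_upwards [h, h'] with x hx hx'
    rw [hx, hx']; rfl
  add_mem' := fun {f g} hf hg => by
    simp only [Set.mem_ofPred_eq] at hf hg ⊢
    have h := Lp.coeFn_add f g
    have h' := (Measure.measurePreserving_neg (volume : Measure ℝ)).quasiMeasurePreserving.ae h
    filter_upwards [h, h', hf, hg] with x hx hx' hfx hgx
    rw [hx, hx', Pi.add_apply, Pi.add_apply, hfx, hgx]
  smul_mem' := fun c f hf => by
    simp only [Set.mem_ofPred_eq] at hf ⊢
    have h := Lp.coeFn_smul c f
    have h' := (Measure.measurePreserving_neg (volume : Measure ℝ)).quasiMeasurePreserving.ae h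
    filter_upwards [h, h', hf] with x hx hx' hfx
    rw [hx, hx', Pi.smul_apply, Pi.smul_apply, hfx]

theorem mem_evenL2 {f : L2} : f ∈ evenL2 ↔ ∀ᵐ x : ℝ, f (-x) = f x := Iff.rfl

/-- The subspace `(L²_even(ℝ))²` of `(L²(ℝ))²`. -/
def evenL2Pair : Submodule ℝ L2Pair where
  carrier := {V | ∀ i, V i ∈ evenL2}
  zero_mem' := fun _ => evenL2.zero_mem
  add_mem' := fun hV hW i => evenL2.add_mem (hV i) (hW i)
  smul_mem' := fun c _ hV i => evenL2.smul_mem c (hV i)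

theorem mem_evenL2Pair {V : L2Pair} : V ∈ evenL2Pair ↔ ∀ i, V i ∈ evenL2 := Iff.rfl

theorem avg_neg {f : ℝ → ℝ} (hf : ∀ᵐ x : ℝ, f (-x) = f x) (η ξ : ℝ) :
    avg η f (-ξ) = avg η f ξ := by
  have h : ∫ t in (ξ - η / 2)..(ξ + η / 2), f t = ∫ t in (ξ - η / 2)..(ξ + η / 2), f (-t) :=
    intervalIntegral.integral_congr_ae (hf.mono fun x hx _ => hx.symm)
  rw [avg, avg, h, intervalIntegral.integral_comp_neg]
  congr 2 <;> ring

/-- The algebra of operators on `L²(ℝ)` that preserve even functions. -/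
def evenOps : Subalgebra ℝ (L2 →L[ℝ] L2) where
  carrier := {X | ∀ f ∈ evenL2, X f ∈ evenL2}
  mul_mem' := fun hX hY f hf => hX _ (hY f hf)
  add_mem' := fun hX hY f hf => evenL2.add_mem (hX f hf) (hY f hf)
  algebraMap_mem' := fun c f hf => by
    rw [Algebra.algebraMap_eq_smul_one]
    exact evenL2.smul_mem c hf

theorem avgOp_mem_evenOps (η : ℝ) : avgOp η ∈ evenOps := fun f hf => by
  have h := avgOp_coeFn η f
  have h' := (Measure.measurePreserving_neg (volume : Measure ℝ)).quasiMeasurePreserving.ae h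
  rw [mem_evenL2]
  filter_upwards [h, h'] with x hx hx'
  rw [hx, hx', avg_neg (mem_evenL2.1 hf)]

theorem mulOp_mem_evenOps {w : ℝ →ᵇ ℝ} (hw : ∀ x, w (-x) = w x) : mulOp w ∈ evenOps :=
  fun f hf => by
    have h := mulOp_coeFn w f
    have h' := (Measure.measurePreserving_neg (volume : Measure ℝ)).quasiMeasurePreserving.ae h
    rw [mem_evenL2]
    filter_upwards [h, h', mem_evenL2.1 hf] with x hx hx' hfx
    rw [hx, hx', hw, hfx]

theorem Coeffs.Lop_mem {M : ℕ} (P : Coeffs M) (ε : ℝ) (V : L2Pair) (hV : V ∈ evenL2Pair) :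
    P.Lop ε V ∈ evenL2Pair := by
  have hcan : ∀ i j, P.Bcan ε i j ∈ evenOps := fun i j =>
    evenOps.smul_mem (evenOps.sub_mem (evenOps.smul_mem evenOps.one_mem _)
      (evenOps.sum_mem fun m _ => evenOps.smul_mem (evenOps.pow_mem (avgOp_mem_evenOps _) _) _)) _
  have hB : ∀ i j, P.B ε i j ∈ evenOps := fun i j => by
    rw [Coeffs.B, Matrix.mul_apply]
    exact evenOps.sum_mem fun l _ => evenOps.mul_mem (evenOps.algebraMap_mem _) (hcan l j)
  have hM : ∀ i j, P.Mop ε i j ∈ evenOps := fun i j => by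
    refine evenOps.smul_mem (evenOps.sum_mem fun m _ => evenOps.smul_mem ?_ _) _
    refine evenOps.mul_mem (evenOps.mul_mem (avgOp_mem_evenOps _) (mulOp_mem_evenOps ?_))
      (avgOp_mem_evenOps _)
    refine avg_neg (Filter.Eventually.of_forall fun x => ?_) _
    simp [Coeffs.kdvWave]
  intro i
  rw [Coeffs.Lop, matOp_apply]
  exact evenL2.sum_mem fun j _ => evenOps.sub_mem (hB i j) (hM i j) _ (hV j)

/-- The linearized operator `ℒ_ε` as a bounded operator on `(L²_even(ℝ))²`. -/
def Coeffs.LopEven {M : ℕ} (P : Coeffs M) (ε : ℝ) : evenL2Pair →L[ℝ] evenL2Pair :=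
  (P.Lop ε ∘L evenL2Pair.subtypeL).codRestrict evenL2Pair
    (fun V => P.Lop_mem ε V V.2)

end LatticeWave

end

/-!
The idea is that, as `ε → 0`, the equation `ℒ_ε V = G` forces `V` to be close to a multiple
`(v, λ v)` of the kernel vector of the rank one matrix `D = σ₀ - (c₁, c₂; c₂, c₃)`, where `v` solves
the linearized KdV equation. That equation is uniquely solvable among even functions. All
the error terms are `O(ε)` in operator norm, so no compactness argument is needed.

*Reduction by the Fourier transform.* The averaging operator `𝒜_η` is the Fourier multiplier
`sinc (π η ξ)` (`fourierL2_avgOp`), so at the frequency `y = 2πξ` the operator `ε² ℬ_ε^can` has the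
symbol `ε² + D + p(ε y)`, with `p(x) = O(min(|x|, 2)²)` and `det (D + p)` a positive multiple of `T`.
The lower bound on `T` and Cramer's rule show (`symbol_estimate`) that the inverse of the symbol of
`ℬ_ε` is bounded, and that its first column is uniformly close to
`(1, λ) / (1 + λ² + a y²)`, where `a` is the denominator of `d₁` and `d₂`. The second
row of `ℳ_ε` is `O(ε²)`, so `ℒ_ε V = G` gives `V = (1, λ) (1 + λ² - a ∂²)⁻¹ (ℳ_ε V)₁ + O(‖G‖ + ε ‖V‖)`
(`exists_fourier_approx`).

*The limit operator.* Behind the smoothing operator `(1 + λ² - a ∂²)⁻¹`, the averages in the first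
row of `ℳ_ε` may be dropped at the cost of `O(ε)`, because averaging nearly commutes with
multiplication by the Lipschitz function `W_*` (`exists_resolvent_Mop_sub_le`). The limit of
`(ℳ_ε V)₁` is `W_* u` with a linear combination `u` of `V₁`, `V₂`, and the approximation becomes
`u - (d₁ - ∂²)⁻¹ (2 d₂ W_* u) = O(‖G‖ + ε ‖V‖)`.

*The linearized KdV equation.* After rescaling, `-θ'' + d₁ θ - 2 d₂ W_* θ` is the Pöschl–Teller
operator `-∂² + 4 - 12 sech²`. It has the explicit odd decaying zero solution `sech² tanh` and an
explicit even growing one. Variation of constants with these two yields a bound for even solutions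
(`norm_le_of_linearized_kdv`, `linearized_kdv_estimate`); the decaying solution being odd is the
reason for the restriction to even functions. Thus `‖V‖ ≤ C ‖ℒ_ε V‖` for small `ε`
(`Coeffs.exists_norm_le_Lop`).

*Surjectivity.* `ℒ_ε` is the product of the invertible scalar matrix `𝒯_ε` and a symmetric operator,
so a function orthogonal to its range is mapped by the transpose of `𝒯_ε` into its kernel and
vanishes (`Coeffs.eq_zero_of_orthogonal_range`). The range is closed by the a priori estimate.
-/

namespace LatticeWave

open Filter Topology
open scoped FourierTransform SchwartzMap ContDiff

/-! ### The Fourier transform of real square integrable functions -/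

/-- The complex Hilbert space `L²(ℝ; ℂ)`. -/
abbrev L2C : Type := Lp ℂ 2 (volume : Measure ℝ)

/-- The inclusion of the real into the complex `L²` space. -/
noncomputable def complexify : L2 →ₗᵢ[ℝ] L2C where
  toLinearMap := (Complex.ofRealCLM.compLpL 2 volume).toLinearMap
  norm_map' f := by
    refine le_antisymm (Lp.norm_le_norm_of_ae_le ?_) (Lp.norm_le_norm_of_ae_le ?_) <;>
    · filter_upwards [Complex.ofRealCLM.coeFn_compLpL (p := 2) (μ := volume) f] with x hx
      simp at hx
      simp [hx]

theorem complexify_coeFn (f : L2) : complexify f =ᵐ[volume] fun x => (f x : ℂ) := by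
  exact Complex.ofRealCLM.coeFn_compLpL (p := 2) (μ := volume) f

/-- The Fourier transform of real square integrable functions,
with the kernel `exp (-2πi x ξ)`. -/
noncomputable def fourierL2 : L2 →ₗᵢ[ℝ] L2C :=
  { toLinearMap := ((Lp.fourierTransformₗᵢ ℝ ℂ).toLinearEquiv.toLinearMap.restrictScalars ℝ) ∘ₗ
      complexify.toLinearMap
    norm_map' := fun f => ((Lp.fourierTransformₗᵢ ℝ ℂ).norm_map _).trans (complexify.norm_map f) }

theorem fourierL2_apply (f : L2) : fourierL2 f = 𝓕 (complexify f) := rfl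

theorem fourierL2_coeFn_of_schwartz {f : L2} {φ : 𝓢(ℝ, ℂ)}
    (h : ∀ᵐ x, (f x : ℂ) = φ x) : fourierL2 f =ᵐ[volume] 𝓕 (φ : ℝ → ℂ) := by
  have h1 : complexify f = φ.toLp 2 := by
    refine Lp.ext ?_
    filter_upwards [complexify_coeFn f, φ.coeFn_toLp 2 volume, h] with x h1 h2 h3
    rw [h1, h2, h3]
  rw [fourierL2_apply, h1, SchwartzMap.toLp_fourier_eq]
  exact (𝓕 φ).coeFn_toLp 2 volume

/-! ### Multipliers on the complex `L²` space -/

theorem memLp_mulC (b : ℝ →ᵇ ℝ) (f : L2C) : MemLp (fun x => (b x : ℂ) * f x) 2 volume :=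
  ((Lp.memLp f).norm.const_mul ‖b‖).mono
    ((Complex.continuous_ofReal.comp b.continuous).aestronglyMeasurable.mul
      (Lp.aestronglyMeasurable f))
    (Filter.Eventually.of_forall fun x => by
      rw [norm_mul, norm_mul, norm_norm, norm_norm, Complex.norm_real]
      exact mul_le_mul_of_nonneg_right (b.norm_coe_le_norm x) (norm_nonneg _))

/-- Multiplication by a real bounded continuous function on `L²(ℝ; ℂ)`. -/
noncomputable def mulC (b : ℝ →ᵇ ℝ) : L2C →L[ℝ] L2C :=
  LinearMap.mkContinuous
    { toFun := fun f => (memLp_mulC b f).toLp (fun x => (b x : ℂ) * f x)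
      map_add' := fun f g => by
        rw [← MemLp.toLp_add]
        refine MemLp.toLp_congr _ _ ?_
        filter_upwards [Lp.coeFn_add f g] with x hx
        simp only [hx, Pi.add_apply]
        ring
      map_smul' := fun c f => by
        rw [RingHom.id_apply, ← MemLp.toLp_const_smul]
        refine MemLp.toLp_congr _ _ ?_
        filter_upwards [Lp.coeFn_smul c f] with x hx
        simp only [hx, Pi.smul_apply, Complex.real_smul]
        ring }
    ‖b‖ (fun f => by
      refine Lp.norm_le_mul_norm_of_ae_le_mul ?_
      filter_upwards [(memLp_mulC b f).coeFn_toLp] with x hx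
      simp only [LinearMap.coe_mk, AddHom.coe_mk]
      rw [hx, norm_mul, Complex.norm_real]
      exact mul_le_mul_of_nonneg_right (b.norm_coe_le_norm x) (norm_nonneg _))

theorem mulC_coeFn (b : ℝ →ᵇ ℝ) (f : L2C) : mulC b f =ᵐ[volume] fun x => (b x : ℂ) * f x :=
  (memLp_mulC b f).coeFn_toLp

/-- The symbol `ξ ↦ sinc (π η ξ)` of the averaging operator. -/
noncomputable def sincBCF (η : ℝ) : ℝ →ᵇ ℝ :=
  BoundedContinuousFunction.ofNormedAddCommGroup (fun ξ => Real.sinc (Real.pi * η * ξ))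
    (Real.continuous_sinc.comp (continuous_const.mul continuous_id)) 1
    (fun _ => Real.abs_sinc_le_one _)

theorem sincBCF_apply (η ξ : ℝ) : sincBCF η ξ = Real.sinc (Real.pi * η * ξ) := rfl

/-! ### The averaging operator is the Fourier multiplier `sinc (π η ξ)` -/

theorem hasDerivAt_avg (η : ℝ) {f : ℝ → ℝ} (hf : Continuous f) (x : ℝ) :
    HasDerivAt (avg η f) (η⁻¹ * (f (x + η / 2) - f (x - η / 2))) x := by
  have h0 : ∀ y, HasDerivAt (fun y => ∫ t in (0 : ℝ)..y, f t) (f y) y := fun y =>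
    intervalIntegral.integral_hasDerivAt_right (hf.intervalIntegrable _ _)
      hf.stronglyMeasurable.stronglyMeasurableAtFilter hf.continuousAt
  have h1 : avg η f = fun ξ => η⁻¹ *
      ((∫ t in (0 : ℝ)..(ξ + η / 2), f t) - ∫ t in (0 : ℝ)..(ξ - η / 2), f t) := by
    funext ξ
    rw [avg, intervalIntegral.integral_interval_sub_left (hf.intervalIntegrable _ _)
      (hf.intervalIntegrable _ _)]
  rw [h1]
  exact (((h0 _).comp_add_const x (η / 2)).sub ((h0 _).comp_sub_const x (η / 2))).const_mul _

theorem contDiff_avg (η : ℝ) {f : ℝ → ℝ} (hf : ContDiff ℝ ∞ f) : ContDiff ℝ ∞ (avg η f) := by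
  rw [contDiff_infty_iff_deriv]
  refine ⟨fun x => (hasDerivAt_avg η hf.continuous x).differentiableAt, ?_⟩
  have : deriv (avg η f) = fun x => η⁻¹ * (f (x + η / 2) - f (x - η / 2)) :=
    funext fun x => (hasDerivAt_avg η hf.continuous x).deriv
  rw [this]
  fun_prop

theorem hasCompactSupport_avg (η : ℝ) {f : ℝ → ℝ} (hf : HasCompactSupport f) :
    HasCompactSupport (avg η f) := by
  obtain ⟨r, hr⟩ := hf.isCompact.isBounded.subset_closedBall 0
  refine HasCompactSupport.intro (isCompact_closedBall (0 : ℝ) (r + |η|)) fun x hx => ?_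
  rw [avg]
  have : ∫ t in (x - η / 2)..(x + η / 2), f t = ∫ t in (x - η / 2)..(x + η / 2), (0 : ℝ) := by
    refine intervalIntegral.integral_congr fun t ht => ?_
    by_contra hne
    have h1 : t ∈ Metric.closedBall (0 : ℝ) r := hr (subset_tsupport f hne)
    simp only [Metric.mem_closedBall, dist_zero_right, Real.norm_eq_abs, not_le] at h1 hx
    have h2 : |t - x| ≤ |η| := by
      rw [Set.mem_uIcc] at ht
      rcases le_total 0 η with h | h
      · rw [abs_of_nonneg h, abs_le]; rcases ht with ht | ht <;> constructor <;> linarith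
      · rw [abs_of_nonpos h, abs_le]; rcases ht with ht | ht <;> constructor <;> linarith
    have h3 : |x| ≤ |t| + |t - x| := by
      have := abs_sub t (t - x)
      simpa using this
    linarith
  rw [this]
  simp

theorem fourier_translate (f : ℝ → ℂ) (a ξ : ℝ) :
    𝓕 (fun x => f (x + a)) ξ = Complex.exp (2 * Real.pi * Complex.I * (a * ξ)) * 𝓕 f ξ := by
  have h := congrFun (VectorFourier.fourierIntegral_comp_add_right Real.fourierChar volume
    (innerₗ ℝ) f a) ξ
  change VectorFourier.fourierIntegral _ _ _ _ _ = _
  rw [Function.comp_def] at h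
  rw [h]
  change (Real.fourierChar _ : Circle) • 𝓕 f ξ = _
  rw [Circle.smul_def, Real.fourierChar_apply, smul_eq_mul]
  congr 2
  simp
  ring

theorem fourier_avg (η : ℝ) (hη : η ≠ 0) {f : ℝ → ℝ} (hf : ContDiff ℝ ∞ f)
    (hc : HasCompactSupport f) {ξ : ℝ} (hξ : ξ ≠ 0) :
    𝓕 (fun x => (avg η f x : ℂ)) ξ
      = (Real.sinc (Real.pi * η * ξ) : ℂ) * 𝓕 (fun x => (f x : ℂ)) ξ := by
  have hd : ∀ x, HasDerivAt (fun x => (avg η f x : ℂ))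
      ((η : ℂ)⁻¹ * ((f (x + η / 2) : ℂ) - f (x + -(η / 2)))) x := fun x => by
    have h := (hasDerivAt_avg η hf.continuous x).ofReal_comp
    rw [← sub_eq_add_neg]
    push_cast at h
    exact h
  have hder : deriv (fun x => (avg η f x : ℂ)) =
      fun x => (η : ℂ)⁻¹ * ((f (x + η / 2) : ℂ) - f (x + -(η / 2))) := funext fun x => (hd x).deriv
  have hint : Integrable (fun x => (f x : ℂ)) :=
    (hf.continuous.integrable_of_hasCompactSupport hc).ofReal
  have hint1 : Integrable (fun x => (avg η f x : ℂ)) :=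
    ((contDiff_avg η hf).continuous.integrable_of_hasCompactSupport
      (hasCompactSupport_avg η hc)).ofReal
  have hi1 := hint.comp_add_right (η / 2)
  have hi2 := hint.comp_add_right (-(η / 2))
  have hint2 : Integrable (deriv fun x => (avg η f x : ℂ)) := by
    rw [hder]
    exact (hi1.sub hi2).const_mul _
  have h1 := congrFun (Real.fourier_deriv hint1 (fun x => (hd x).differentiableAt) hint2) ξ
  have h2 : 𝓕 (deriv fun x => (avg η f x : ℂ)) ξ = (η : ℂ)⁻¹ *
      (𝓕 (fun x => (f (x + η / 2) : ℂ)) ξ - 𝓕 (fun x => (f (x + -(η / 2)) : ℂ)) ξ) := by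
    rw [hder]
    simp only [Real.fourier_eq]
    rw [← integral_sub, ← integral_const_mul]
    · refine integral_congr_ae (Filter.Eventually.of_forall fun x => ?_)
      simp only [Circle.smul_def, smul_eq_mul]
      ring
    · exact (Real.fourierIntegral_convergent_iff ξ).2 hi1
    · exact (Real.fourierIntegral_convergent_iff ξ).2 hi2
  rw [fourier_translate (fun x => (f x : ℂ)), fourier_translate (fun x => (f x : ℂ))] at h2
  rw [h2, smul_eq_mul] at h1
  have hπ : (Real.pi : ℂ) ≠ 0 := by exact_mod_cast Real.pi_ne_zero
  have hη' : (η : ℂ) ≠ 0 := by exact_mod_cast hη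
  have hξ' : (ξ : ℂ) ≠ 0 := by exact_mod_cast hξ
  have hne : Real.pi * η * ξ ≠ 0 := by positivity
  rw [Real.sinc_of_ne_zero hne]
  push_cast
  rw [Complex.sin]
  have e1 : (2 * (Real.pi : ℂ) * Complex.I * (((η / 2 : ℝ) : ℂ) * ξ))
      = (Real.pi * η * ξ) * Complex.I := by push_cast; ring
  have e2 : (2 * (Real.pi : ℂ) * Complex.I * (((-(η / 2) : ℝ) : ℂ) * ξ))
      = -(Real.pi * η * ξ) * Complex.I := by push_cast; ring
  rw [e1, e2] at h1
  have hI : Complex.I ≠ 0 := Complex.I_ne_zero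
  have h3 : 2 * Real.pi * Complex.I * ξ * (𝓕 (fun x => (avg η f x : ℂ)) ξ) * η =
     (Complex.exp (Real.pi * η * ξ * Complex.I) - Complex.exp (-(Real.pi * η * ξ) * Complex.I))
       * 𝓕 (fun x => (f x : ℂ)) ξ := by
    rw [← h1]; field_simp
  rw [div_mul_eq_mul_div, eq_div_iff (by positivity)]
  have h4 := congrArg (fun z => -(Complex.I / 2) * z) h3
  linear_combination h4 + Real.pi * ξ * (𝓕 (fun x => (avg η f x : ℂ)) ξ) * η * Complex.I_sq

/-- Smooth compactly supported functions are dense in the real `L²` space. -/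
theorem dense_smooth : Dense {f : L2 | ∃ g : ℝ → ℝ, f =ᵐ[volume] g ∧ HasCompactSupport g ∧
    ContDiff ℝ ∞ g} :=
  Lp.dense_hasCompactSupport_contDiff (by norm_num)

theorem ofReal_comp_smooth {g : ℝ → ℝ} (hc : HasCompactSupport g) (hs : ContDiff ℝ ∞ g) :
    ∃ φ : 𝓢(ℝ, ℂ), ∀ x, φ x = g x :=
  ⟨HasCompactSupport.toSchwartzMap (f := fun x => (g x : ℂ))
    (hc.comp_left (g := ((↑) : ℝ → ℂ)) (by simp)) (Complex.ofRealCLM.contDiff.comp hs),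
    fun _ => rfl⟩

theorem fourierL2_avgOp {η : ℝ} (hη : η ≠ 0) (f : L2) :
    fourierL2 (avgOp η f) = mulC (sincBCF η) (fourierL2 f) := by
  have hcl : IsClosed {f : L2 | fourierL2 (avgOp η f) = mulC (sincBCF η) (fourierL2 f)} :=
    isClosed_eq (fourierL2.continuous.comp (avgOp η).continuous)
      ((mulC _).continuous.comp fourierL2.continuous)
  refine (hcl.closure_subset_iff.2 ?_) (dense_smooth f)
  rintro f ⟨g, hfg, hc, hs⟩
  obtain ⟨φ, hφ⟩ := ofReal_comp_smooth hc hs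
  obtain ⟨ψ, hψ⟩ := ofReal_comp_smooth (hasCompactSupport_avg η hc) (contDiff_avg η hs)
  have h1 := fourierL2_coeFn_of_schwartz (f := f) (φ := φ)
    (hfg.mono fun x hx => by rw [hx, hφ])
  have h2 := fourierL2_coeFn_of_schwartz (f := avgOp η f) (φ := ψ)
    ((avgOp_coeFn η f).mono fun x hx => by rw [hx, hψ, avg_congr η hfg])
  have hne : ∀ᵐ ξ : ℝ, ξ ≠ 0 := by simp [ae_iff]
  refine Lp.ext ?_
  filter_upwards [h1, h2, mulC_coeFn (sincBCF η) (fourierL2 f), hne] with ξ e1 e2 e3 e4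
  rw [e2, e3, e1, sincBCF_apply]
  have e5 : (φ : ℝ → ℂ) = fun x => (g x : ℂ) := funext hφ
  have e6 : (ψ : ℝ → ℂ) = fun x => (avg η g x : ℂ) := funext hψ
  rw [e5, e6, fourier_avg η hη hs hc e4]

theorem avgOp_zero : avgOp 0 = 0 := by
  ext1 f
  refine Lp.ext ?_
  filter_upwards [avgOp_coeFn 0 f, Lp.coeFn_zero ℝ 2 (volume : Measure ℝ)] with x h1 h2
  rw [h1, zero_apply, h2]
  simp [avg]

/-! ### The linearized KdV equation -/

/-- The odd decaying solution `sech² t tanh t` of `p'' = (4 - 12 sech² t) p`. -/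
noncomputable def oddSol (t : ℝ) : ℝ := Real.sinh t / Real.cosh t ^ 3

/-- The derivative of `oddSol`. -/
noncomputable def oddSol' (t : ℝ) : ℝ :=
  (Real.cosh t ^ 2 - 3 * Real.sinh t ^ 2) / Real.cosh t ^ 4

/-- The even growing solution of `p'' = (4 - 12 sech² t) p`, obtained from `oddSol` by reduction of
order: it is the product of `oddSol` and a primitive of `1 / oddSol²`. -/
noncomputable def evenSol (t : ℝ) : ℝ :=
  Real.cosh t ^ 2 / 4 + 5 / 8 - 15 / 8 / Real.cosh t ^ 2 + 15 / 8 * (t * oddSol t)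

/-- The derivative of `evenSol`. -/
noncomputable def evenSol' (t : ℝ) : ℝ :=
  Real.sinh t * Real.cosh t / 2 + 15 / 4 * oddSol t + 15 / 8 * (oddSol t + t * oddSol' t)

theorem hasDerivAt_oddSol (t : ℝ) : HasDerivAt oddSol (oddSol' t) t := by
  have hc := (Real.cosh_pos t).ne'
  have h := (Real.hasDerivAt_sinh t).div ((Real.hasDerivAt_cosh t).pow 3) (pow_ne_zero 3 hc)
  refine h.congr_deriv ?_
  rw [oddSol']
  simp only [Pi.pow_apply]
  field_simp
  ring

theorem hasDerivAt_oddSol' (t : ℝ) :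
    HasDerivAt oddSol' ((4 - 12 / Real.cosh t ^ 2) * oddSol t) t := by
  have hc := (Real.cosh_pos t).ne'
  have h := ((((Real.hasDerivAt_cosh t).pow 2).sub
    (((Real.hasDerivAt_sinh t).pow 2).const_mul 3))).div
    ((Real.hasDerivAt_cosh t).pow 4) (pow_ne_zero 4 hc)
  refine h.congr_deriv ?_
  simp only [oddSol, Pi.pow_apply, Pi.sub_apply]
  field_simp
  push_cast
  have := Real.sinh_sq t
  linear_combination 12 * Real.sinh t * Real.cosh t ^ 3 * this

theorem hasDerivAt_evenSol (t : ℝ) : HasDerivAt evenSol (evenSol' t) t := by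
  have hc := (Real.cosh_pos t).ne'
  have h := (((((Real.hasDerivAt_cosh t).pow 2).div_const 4).add_const (5 / 8 : ℝ)).sub
    ((hasDerivAt_const t (15 / 8 : ℝ)).div ((Real.hasDerivAt_cosh t).pow 2) (pow_ne_zero 2 hc))).add
    (((hasDerivAt_id t).mul (hasDerivAt_oddSol t)).const_mul (15 / 8))
  refine h.congr_deriv ?_
  simp only [oddSol, evenSol', Pi.pow_apply, id]
  field_simp
  ring

theorem hasDerivAt_evenSol' (t : ℝ) :
    HasDerivAt evenSol' ((4 - 12 / Real.cosh t ^ 2) * evenSol t) t := by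
  have hc := (Real.cosh_pos t).ne'
  have h := ((((Real.hasDerivAt_sinh t).mul (Real.hasDerivAt_cosh t)).div_const 2).add
    ((hasDerivAt_oddSol t).const_mul (15 / 4))).add
    (((hasDerivAt_oddSol t).add ((hasDerivAt_id t).mul (hasDerivAt_oddSol' t))).const_mul (15 / 8))
  refine h.congr_deriv ?_
  simp only [oddSol, oddSol', evenSol, id]
  have := Real.sinh_sq t
  field_simp
  rw [this]
  ring

theorem wronskian_eq_one (t : ℝ) : oddSol t * evenSol' t - oddSol' t * evenSol t = 1 := by
  have hc := (Real.cosh_pos t).ne'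
  simp only [oddSol, oddSol', evenSol, evenSol']
  have h2 := Real.sinh_sq t
  have h4 : Real.sinh t ^ 4 = (Real.cosh t ^ 2 - 1) ^ 2 := by rw [← h2]; ring
  field_simp
  ring_nf
  rw [h2]
  ring

theorem abs_sinh_le_cosh (t : ℝ) : |Real.sinh t| ≤ Real.cosh t := by
  refine abs_le_of_sq_le_sq ?_ (Real.cosh_pos t).le
  rw [Real.sinh_sq]; linarith

theorem abs_le_cosh (t : ℝ) : |t| ≤ Real.cosh t := by
  rw [← Real.cosh_abs]
  have h := Real.self_le_sinh_iff.2 (abs_nonneg t)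
  exact h.trans ((le_abs_self _).trans (abs_sinh_le_cosh _))

theorem abs_oddSol_le (t : ℝ) : |oddSol t| ≤ 1 / Real.cosh t ^ 2 := by
  have hc := Real.cosh_pos t
  rw [oddSol, abs_div, abs_of_pos (pow_pos hc 3), div_le_div_iff₀ (by positivity) (by positivity)]
  have := abs_sinh_le_cosh t
  nlinarith [mul_le_mul_of_nonneg_right this (pow_pos hc 2).le]

theorem abs_oddSol'_le (t : ℝ) : |oddSol' t| ≤ 3 := by
  have hc := Real.one_le_cosh t
  have hc2 : 1 ≤ Real.cosh t ^ 2 := one_le_pow₀ hc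
  have h2 := Real.sinh_sq t
  rw [oddSol', abs_div, abs_of_pos (by positivity : 0 < Real.cosh t ^ 4),
    div_le_iff₀ (by positivity), abs_le]
  constructor <;> nlinarith

theorem abs_evenSol_le (t : ℝ) : |evenSol t| ≤ 5 * Real.cosh t ^ 2 := by
  have hc := Real.one_le_cosh t
  have hc2 : 1 ≤ Real.cosh t ^ 2 := one_le_pow₀ hc
  have h1 : |t * oddSol t| ≤ 1 := by
    rw [abs_mul]
    calc |t| * |oddSol t| ≤ Real.cosh t * (1 / Real.cosh t ^ 2) :=
          mul_le_mul (abs_le_cosh t) (abs_oddSol_le t) (abs_nonneg _) (by positivity)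
      _ = 1 / Real.cosh t := by field_simp
      _ ≤ 1 := by rw [div_le_one (by positivity)]; exact hc
  have h2 : 15 / 8 / Real.cosh t ^ 2 ≤ 15 / 8 := div_le_self (by norm_num) hc2
  have h3 : 0 ≤ 15 / 8 / Real.cosh t ^ 2 := by positivity
  rw [abs_le] at h1
  rw [evenSol, abs_le]
  constructor <;> linarith [h1.1, h1.2]

/-- The derivative of the Wronskian of a solution of `p'' = q p` and a solution of
`θ'' = q θ - g`. -/
theorem hasDerivAt_wronskian {p p' q : ℝ → ℝ} {θ θ' g : ℝ → ℂ} {x : ℝ}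
    (hp : HasDerivAt p (p' x) x) (hp' : HasDerivAt p' (q x * p x) x)
    (hθ : HasDerivAt θ (θ' x) x) (hθ' : HasDerivAt θ' (q x * θ x - g x) x) :
    HasDerivAt (fun y => (p y : ℂ) * θ' y - p' y * θ y) (-(p x * g x)) x := by
  refine ((hp.ofReal_comp.mul hθ').sub (hp'.ofReal_comp.mul hθ)).congr_deriv ?_
  push_cast
  ring

/-- A decaying even solution `θ` of `-θ'' + 4 s² θ - 12 s² sech² (s x) (θ + f) = 0` is controlled
by a weighted `L¹` norm of `f`: variation of constants with the two homogeneous solutions. -/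
theorem norm_le_of_linearized_kdv {s E : ℝ} (hs : 0 < s) {θ θ' f : ℝ → ℂ} (hf : Continuous f)
    (hE : ∀ a b, a ≤ b → ∫ y in a..b, ‖f y‖ / Real.cosh (s * y) ≤ E)
    (hθ : ∀ x, HasDerivAt θ (θ' x) x)
    (hθ' : ∀ x, HasDerivAt θ'
      (4 * s ^ 2 * θ x - ((12 * s ^ 2 / Real.cosh (s * x) ^ 2 : ℝ) : ℂ) * (θ x + f x)) x)
    (h0 : θ' 0 = 0) (hlim : Tendsto θ atTop (𝓝 0)) (hlim' : Tendsto θ' atTop (𝓝 0))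
    {x : ℝ} (hx : 0 ≤ x) : ‖θ x‖ ≤ 120 * s * E / Real.cosh (s * x) := by
  have hcpos : ∀ y, 0 < Real.cosh (s * y) := fun y => Real.cosh_pos _
  have hmono : ∀ a b, 0 ≤ a → a ≤ b → Real.cosh (s * a) ≤ Real.cosh (s * b) := fun a b ha hab => by
    rw [Real.cosh_le_cosh, abs_of_nonneg (by positivity), abs_of_nonneg (by nlinarith)]
    nlinarith
  set g : ℝ → ℂ := fun y => ((12 * s ^ 2 / Real.cosh (s * y) ^ 2 : ℝ) : ℂ) * f y with hg
  set q : ℝ → ℝ := fun y => s ^ 2 * (4 - 12 / Real.cosh (s * y) ^ 2) with hq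
  have hθ'' : ∀ y, HasDerivAt θ' (q y * θ y - g y) y := fun y => by
    refine (hθ' y).congr_deriv ?_
    simp only [hq, hg]
    push_cast
    ring
  have hchain : ∀ {p : ℝ → ℝ} {p1 : ℝ} (y : ℝ), HasDerivAt p p1 (s * y) →
      HasDerivAt (fun y => p (s * y)) (s * p1) y := fun y hp => by
    have := hp.comp y ((hasDerivAt_id y).const_mul s)
    exact this.congr_deriv (by ring)
  have hI : ∀ y, HasDerivAt (fun y => (oddSol (s * y) : ℂ) * θ' y -
      ((s * oddSol' (s * y) : ℝ) : ℂ) * θ y) (-(oddSol (s * y) * g y)) y := fun y =>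
    hasDerivAt_wronskian (p := fun y => oddSol (s * y)) (p' := fun y => s * oddSol' (s * y)) (q := q)
      (hchain y (hasDerivAt_oddSol _))
      (((hchain y (hasDerivAt_oddSol' _)).const_mul s).congr_deriv (by simp only [hq]; ring))
      (hθ y) (hθ'' y)
  have hJ : ∀ y, HasDerivAt (fun y => (evenSol (s * y) : ℂ) * θ' y -
      ((s * evenSol' (s * y) : ℝ) : ℂ) * θ y) (-(evenSol (s * y) * g y)) y := fun y =>
    hasDerivAt_wronskian (p := fun y => evenSol (s * y)) (p' := fun y => s * evenSol' (s * y))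
      (q := q) (hchain y (hasDerivAt_evenSol _))
      (((hchain y (hasDerivAt_evenSol' _)).const_mul s).congr_deriv (by simp only [hq]; ring))
      (hθ y) (hθ'' y)
  set I := fun y => (oddSol (s * y) : ℂ) * θ' y - ((s * oddSol' (s * y) : ℝ) : ℂ) * θ y with hIdef
  set J := fun y => (evenSol (s * y) : ℂ) * θ' y - ((s * evenSol' (s * y) : ℝ) : ℂ) * θ y
    with hJdef
  have hgc : Continuous g := by
    refine Continuous.mul (Complex.continuous_ofReal.comp (continuous_const.div ?_ ?_)) hf
    · fun_prop
    · intro y; exact (pow_pos (hcpos y) 2).ne'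
  have hoc : Continuous oddSol := continuous_iff_continuousAt.2 fun t =>
    (hasDerivAt_oddSol t).continuousAt
  have hec : Continuous evenSol := continuous_iff_continuousAt.2 fun t =>
    (hasDerivAt_evenSol t).continuousAt
  have hwc : Continuous fun y => ‖f y‖ / Real.cosh (s * y) :=
    hf.norm.div (by fun_prop) fun y => (hcpos y).ne'
  have hEn : ∀ a b, a ≤ b → ∀ (F : ℝ → ℂ) (A : ℝ), 0 ≤ A →
      (∀ y, a ≤ y → y ≤ b → ‖F y‖ ≤ A * (‖f y‖ / Real.cosh (s * y))) →
      ‖∫ y in a..b, F y‖ ≤ A * E := by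
    intro a b hab F A hA hF
    refine (intervalIntegral.norm_integral_le_of_norm_le hab
      (ae_of_all _ fun y hy => hF y hy.1.le hy.2)
      ((hwc.intervalIntegrable _ _).const_mul A)).trans ?_
    rw [intervalIntegral.integral_const_mul]
    exact mul_le_mul_of_nonneg_left (hE a b hab) hA
  have hgn : ∀ y, ‖g y‖ = 12 * s ^ 2 / Real.cosh (s * y) ^ 2 * ‖f y‖ := fun y => by
    simp only [hg]
    rw [norm_mul, Complex.norm_real, Real.norm_of_nonneg (by positivity)]
  -- the Wronskian with the decaying solution vanishes at infinity
  have hIlim : Tendsto I atTop (𝓝 0) := by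
    have h1 : Tendsto (fun y => (oddSol (s * y) : ℂ) * θ' y) atTop (𝓝 0) := by
      refine squeeze_zero_norm (fun y => ?_) (tendsto_zero_iff_norm_tendsto_zero.1 hlim')
      rw [norm_mul, Complex.norm_real]
      refine mul_le_of_le_one_left (norm_nonneg _) ((abs_oddSol_le _).trans ?_)
      exact (div_le_one (by positivity)).2 (one_le_pow₀ (Real.one_le_cosh _))
    have h2 : Tendsto (fun y => ((s * oddSol' (s * y) : ℝ) : ℂ) * θ y) atTop (𝓝 0) := by
      have h3 : Tendsto (fun y => s * 3 * ‖θ y‖) atTop (𝓝 0) := by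
        simpa using (tendsto_zero_iff_norm_tendsto_zero.1 hlim).const_mul (s * 3)
      refine squeeze_zero_norm (fun y => ?_) h3
      rw [norm_mul, Complex.norm_real, norm_mul, Real.norm_of_nonneg hs.le]
      exact mul_le_mul_of_nonneg_right
        (mul_le_mul_of_nonneg_left (abs_oddSol'_le _) hs.le) (norm_nonneg _)
    have h3 := h1.sub h2
    rwa [sub_zero] at h3
  have hIb : ‖I x‖ ≤ 12 * s ^ 2 / Real.cosh (s * x) ^ 3 * E := by
    have hX : ∀ X, x ≤ X → ‖I x‖ ≤ ‖I X‖ + 12 * s ^ 2 / Real.cosh (s * x) ^ 3 * E := by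
      intro X hX
      have hint := intervalIntegral.integral_eq_sub_of_hasDerivAt (a := x) (b := X)
        (fun y _ => hI y)
        (((Complex.continuous_ofReal.comp (hoc.comp (by fun_prop))).mul hgc).neg.intervalIntegrable
          _ _)
      have hb := hEn x X hX (fun y => -((oddSol (s * y) : ℂ) * g y))
        (12 * s ^ 2 / Real.cosh (s * x) ^ 3) (div_nonneg (by positivity) (pow_pos (hcpos x) 3).le) (by
        intro y hy _
        rw [norm_neg, norm_mul, Complex.norm_real, hgn]
        have h1 := hmono x y hx hy
        calc ‖oddSol (s * y)‖ * (12 * s ^ 2 / Real.cosh (s * y) ^ 2 * ‖f y‖)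
            ≤ (1 / Real.cosh (s * y) ^ 2) * (12 * s ^ 2 / Real.cosh (s * y) ^ 2 * ‖f y‖) :=
              mul_le_mul_of_nonneg_right (abs_oddSol_le _) (by positivity)
          _ = 12 * s ^ 2 / Real.cosh (s * y) ^ 3 * (‖f y‖ / Real.cosh (s * y)) := by
              have := (hcpos y).ne'
              field_simp
          _ ≤ _ := by
              refine mul_le_mul_of_nonneg_right ?_ (div_nonneg (norm_nonneg _) (hcpos y).le)
              exact div_le_div_of_nonneg_left (by positivity) (pow_pos (hcpos x) 3)
                (pow_le_pow_left₀ (hcpos x).le h1 3))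
      have : I x = I X - ∫ y in x..X, -((oddSol (s * y) : ℂ) * g y) := by
        rw [hint]; simp only [hIdef]; ring
      rw [this]
      exact (norm_sub_le _ _).trans (add_le_add_right hb _)
    have hl := (tendsto_zero_iff_norm_tendsto_zero.1 hIlim).add_const
      (12 * s ^ 2 / Real.cosh (s * x) ^ 3 * E)
    rw [zero_add] at hl
    exact ge_of_tendsto hl ((eventually_ge_atTop x).mono hX)
  have hJb : ‖J x‖ ≤ 60 * s ^ 2 * Real.cosh (s * x) * E := by
    have hint := intervalIntegral.integral_eq_sub_of_hasDerivAt (a := 0) (b := x)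
      (fun y _ => hJ y)
      (((Complex.continuous_ofReal.comp (hec.comp (by fun_prop))).mul hgc).neg.intervalIntegrable
        _ _)
    have hJ0 : J 0 = 0 := by simp [hJdef, h0, evenSol', oddSol]
    rw [hJ0, sub_zero] at hint
    rw [← hint]
    refine hEn 0 x hx _ _ (mul_nonneg (by positivity) (hcpos x).le) ?_
    intro y hy hyx
    rw [norm_neg, norm_mul, Complex.norm_real, hgn]
    have h1 := hmono y x hy hyx
    calc ‖evenSol (s * y)‖ * (12 * s ^ 2 / Real.cosh (s * y) ^ 2 * ‖f y‖)
        ≤ (5 * Real.cosh (s * y) ^ 2) * (12 * s ^ 2 / Real.cosh (s * y) ^ 2 * ‖f y‖) :=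
          mul_le_mul_of_nonneg_right (abs_evenSol_le _) (by positivity)
      _ = 60 * s ^ 2 * Real.cosh (s * y) * (‖f y‖ / Real.cosh (s * y)) := by
          have := (hcpos y).ne'
          field_simp
          ring
      _ ≤ _ := by
          refine mul_le_mul_of_nonneg_right ?_ (div_nonneg (norm_nonneg _) (hcpos y).le)
          exact mul_le_mul_of_nonneg_left h1 (by positivity)
  have hrep : (s : ℂ) * θ x = evenSol (s * x) * I x - oddSol (s * x) * J x := by
    have hw : ((oddSol (s * x) * evenSol' (s * x) - oddSol' (s * x) * evenSol (s * x) : ℝ) : ℂ) = 1 :=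
      by rw [wronskian_eq_one]; simp
    push_cast at hw
    simp only [hIdef, hJdef]
    push_cast
    linear_combination -(s * θ x) * hw
  have hn : s * ‖θ x‖ ≤ 5 * Real.cosh (s * x) ^ 2 * (12 * s ^ 2 / Real.cosh (s * x) ^ 3 * E)
      + 1 / Real.cosh (s * x) ^ 2 * (60 * s ^ 2 * Real.cosh (s * x) * E) := by
    have : s * ‖θ x‖ = ‖(s : ℂ) * θ x‖ := by
      rw [norm_mul, Complex.norm_real, Real.norm_of_nonneg hs.le]
    rw [this, hrep]
    refine (norm_sub_le _ _).trans (add_le_add ?_ ?_)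
    · rw [norm_mul, Complex.norm_real]
      exact mul_le_mul (abs_evenSol_le _) hIb (norm_nonneg _) (by positivity)
    · rw [norm_mul, Complex.norm_real]
      exact mul_le_mul (abs_oddSol_le _) hJb (norm_nonneg _) (by positivity)
  have hc := hcpos x
  have he : 5 * Real.cosh (s * x) ^ 2 * (12 * s ^ 2 / Real.cosh (s * x) ^ 3 * E)
      + 1 / Real.cosh (s * x) ^ 2 * (60 * s ^ 2 * Real.cosh (s * x) * E)
      = s * (120 * s * E / Real.cosh (s * x)) := by
    field_simp
    ring
  rw [he] at hn
  exact le_of_mul_le_mul_left hn hs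

/-! ### Coercivity of the linearized KdV operator on even functions -/

/-- The symbol `ξ ↦ 1 / (p + q (2πξ)²)` of `(p - q ∂²)⁻¹`. -/
noncomputable def resolventSymbol (p q : ℝ) (hp : 0 < p) (hq : 0 < q) : ℝ →ᵇ ℝ :=
  BoundedContinuousFunction.ofNormedAddCommGroup
    (fun ξ => 1 / (p + q * (2 * Real.pi * ξ) ^ 2))
    (continuous_const.div (by fun_prop) fun ξ => by positivity) (1 / p) (fun ξ => by
      rw [Real.norm_of_nonneg (by positivity)]
      exact one_div_le_one_div_of_le hp (le_add_of_nonneg_right (by positivity)))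

theorem resolventSymbol_apply {p q : ℝ} (hp : 0 < p) (hq : 0 < q) (ξ : ℝ) :
    resolventSymbol p q hp hq ξ = 1 / (p + q * (2 * Real.pi * ξ) ^ 2) := rfl

theorem hasTemperateGrowth_resolventSymbol {p q : ℝ} (hp : 0 < p) (hq : 0 < q) :
    (fun ξ => ((resolventSymbol p q hp hq ξ : ℝ) : ℂ)).HasTemperateGrowth := by
  have h1 := Function.hasTemperateGrowth_one_add_norm_sq_rpow ℝ (-1)
  have h2 := h1.comp (((2 * Real.pi * √(q / p)) • ContinuousLinearMap.id ℝ ℝ).hasTemperateGrowth)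
  have h3 := (Function.HasTemperateGrowth.const (E := ℝ) (1 / p)).mul h2
  have h4 := Function.Complex.hasTemperateGrowth_ofReal.comp h3
  refine (congrArg _ (funext fun ξ => ?_)).mpr h4
  simp only [Function.comp_apply, Pi.mul_apply, resolventSymbol_apply]
  congr 1
  have h5 : √(q / p) ^ 2 = q / p := Real.sq_sqrt (by positivity)
  have h6 : ‖((2 * Real.pi * √(q / p)) • ContinuousLinearMap.id ℝ ℝ) ξ‖ ^ 2
      = (2 * Real.pi * ξ) ^ 2 * (q / p) := by
    rw [Real.norm_eq_abs, sq_abs, ← h5]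
    simp
    ring
  rw [h6, Real.rpow_neg_one]
  field_simp

theorem fourier_sub_schwartz (φ ψ : 𝓢(ℝ, ℂ)) : 𝓕 (φ - ψ) = 𝓕 φ - 𝓕 ψ := by
  rw [sub_eq_add_neg, FourierTransform.fourier_add, FourierTransform.fourier_neg, sub_eq_add_neg]

theorem fourier_deriv_schwartz (θ : 𝓢(ℝ, ℂ)) (ξ : ℝ) :
    𝓕 (SchwartzMap.derivCLM ℝ ℂ θ) ξ = 2 * Real.pi * Complex.I * ξ * 𝓕 θ ξ := by
  have h := congrFun (Real.fourier_deriv θ.integrable θ.differentiable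
    (SchwartzMap.derivCLM ℝ ℂ θ).integrable) ξ
  exact h

/-- Solvability of `p θ - q θ'' = h` in the Schwartz space; the solution is even if `h` is. -/
theorem exists_schwartz_resolvent {p q : ℝ} (hp : 0 < p) (hq : 0 < q) (h : 𝓢(ℝ, ℂ))
    (heven : ∀ x, h (-x) = h x) :
    ∃ θ : 𝓢(ℝ, ℂ), (∀ ξ, 𝓕 θ ξ = (resolventSymbol p q hp hq ξ : ℂ) * 𝓕 h ξ) ∧
      (∀ x, SchwartzMap.derivCLM ℝ ℂ (SchwartzMap.derivCLM ℝ ℂ θ) x = (p * θ x - h x) / q) ∧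
      ∀ x, θ (-x) = θ x := by
  have hg := hasTemperateGrowth_resolventSymbol hp hq
  set g : 𝓢(ℝ, ℂ) := SchwartzMap.smulLeftCLM ℂ
    (fun ξ => ((resolventSymbol p q hp hq ξ : ℝ) : ℂ)) (𝓕 h) with hgdef
  have hga : ∀ ξ, g ξ = (resolventSymbol p q hp hq ξ : ℂ) * 𝓕 h ξ := fun ξ => by
    rw [hgdef, SchwartzMap.smulLeftCLM_apply_apply hg, smul_eq_mul]
  have hF : 𝓕 (𝓕⁻ g) = g := FourierTransform.fourier_fourierInv_eq g
  have hθ : ∀ ξ, 𝓕 (𝓕⁻ g) ξ = (resolventSymbol p q hp hq ξ : ℂ) * 𝓕 h ξ := fun ξ => by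
    rw [hF, hga]
  refine ⟨𝓕⁻ g, hθ, fun x => ?_, fun x => ?_⟩
  · have hq' : (q : ℂ) ≠ 0 := by exact_mod_cast hq.ne'
    have key : 𝓕 ((p : ℂ) • (𝓕⁻ g) - (q : ℂ) •
        (SchwartzMap.derivCLM ℝ ℂ (SchwartzMap.derivCLM ℝ ℂ (𝓕⁻ g)))) = 𝓕 h := by
      ext ξ
      rw [fourier_sub_schwartz, FourierTransform.fourier_smul,
        FourierTransform.fourier_smul]
      simp only [sub_apply, smul_apply, fourier_deriv_schwartz, hθ,
        smul_eq_mul, resolventSymbol_apply]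
      have : ((p : ℂ) + q * (2 * Real.pi * ξ) ^ 2) ≠ 0 := by
        have : 0 < p + q * (2 * Real.pi * ξ) ^ 2 := by positivity
        exact_mod_cast this.ne'
      have h1 := one_div_mul_cancel this
      push_cast
      linear_combination 𝓕 h ξ * h1 - (q * (2 * Real.pi * ξ) ^ 2 *
        (1 / ((p : ℂ) + q * (2 * Real.pi * ξ) ^ 2) * 𝓕 h ξ)) * Complex.I_sq
    have h2 := congrArg (fun u : 𝓢(ℝ, ℂ) => 𝓕⁻ u) key
    simp only [FourierTransform.fourierInv_fourier_eq] at h2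
    have h3 := congrArg (fun u : 𝓢(ℝ, ℂ) => u x) h2
    simp only [sub_apply, smul_apply, smul_eq_mul] at h3
    rw [eq_div_iff hq', ← h3]
    ring
  · have hFe : ∀ ξ, 𝓕 (h : ℝ → ℂ) (-ξ) = 𝓕 (h : ℝ → ℂ) ξ := fun ξ => by
      rw [← Real.fourierInv_eq_fourier_neg, Real.fourierInv_eq_fourier_comp_neg]
      simp only [heven]
    have hge : ∀ ξ, g (-ξ) = g ξ := fun ξ => by
      rw [hga, hga, resolventSymbol_apply, resolventSymbol_apply, SchwartzMap.fourier_coe, hFe]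
      simp
    rw [SchwartzMap.fourierInv_coe]
    have h1 : 𝓕⁻ (g : ℝ → ℂ) = 𝓕 (g : ℝ → ℂ) := by
      rw [Real.fourierInv_eq_fourier_comp_neg]
      simp only [hge]
    rw [Real.fourierInv_eq_fourier_neg, neg_neg, h1]

theorem memLp_inv_cosh {s : ℝ} (hs : 0 < s) :
    MemLp (fun x => 1 / Real.cosh (s * x)) 2 (volume : Measure ℝ) := by
  have hc : Continuous fun x : ℝ => 1 / Real.cosh (s * x) :=
    continuous_const.div (by fun_prop) fun x => (Real.cosh_pos _).ne'
  rw [memLp_two_iff_integrable_sq hc.aestronglyMeasurable]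
  have h1 : Integrable fun x : ℝ => (1 + (s * x) ^ 2)⁻¹ :=
    integrable_inv_one_add_sq.comp_mul_left' hs.ne'
  refine h1.mono' (hc.pow 2).aestronglyMeasurable (ae_of_all _ fun x => ?_)
  rw [Real.norm_of_nonneg (by positivity), one_div, inv_pow]
  refine inv_anti₀ (by positivity) ?_
  have h2 := Real.self_le_sinh_iff.2 (abs_nonneg (s * x))
  rw [Real.cosh_sq', ← sq_abs (s * x), ← sq_abs (Real.sinh _), Real.abs_sinh]
  gcongr

theorem integral_norm_div_cosh_le {s : ℝ} (hs : 0 < s) (f : 𝓢(ℝ, ℂ)) {a b : ℝ} (hab : a ≤ b) :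
    ∫ y in a..b, ‖f y‖ / Real.cosh (s * y)
      ≤ ‖f.toLp 2 (volume : Measure ℝ)‖ * ‖(memLp_inv_cosh hs).toLp _‖ := by
  set G := (memLp_inv_cosh hs).toLp _ with hG
  have hf : MemLp (fun x => ‖f x‖) 2 (volume : Measure ℝ) := (f.memLp 2).norm
  have hN : ‖hf.toLp _‖ = ‖f.toLp 2 (volume : Measure ℝ)‖ := by
    rw [Lp.norm_toLp, SchwartzMap.norm_toLp, eLpNorm_norm]
  have h1 : inner ℝ G (hf.toLp _) = ∫ y, ‖f y‖ / Real.cosh (s * y) := by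
    rw [L2.inner_def]
    refine integral_congr_ae ?_
    filter_upwards [hf.coeFn_toLp, (memLp_inv_cosh hs).coeFn_toLp] with x h1 h2
    rw [h1, hG, h2]
    simp [div_eq_mul_inv]
  have hint : Integrable fun y => ‖f y‖ / Real.cosh (s * y) := by
    refine (L2.integrable_inner (𝕜 := ℝ) G (hf.toLp _)).congr ?_
    filter_upwards [hf.coeFn_toLp, (memLp_inv_cosh hs).coeFn_toLp] with x h1 h2
    rw [h1, hG, h2]
    simp [div_eq_mul_inv]
  rw [intervalIntegral.integral_of_le hab]
  calc _ ≤ ∫ y, ‖f y‖ / Real.cosh (s * y) :=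
        setIntegral_le_integral hint (ae_of_all _ fun y =>
          div_nonneg (norm_nonneg _) (Real.cosh_pos _).le)
    _ ≤ ‖G‖ * ‖hf.toLp _‖ := by rw [← h1]; exact real_inner_le_norm _ _
    _ = _ := by rw [hN, mul_comm]

/-- The a priori estimate for the linearized KdV equation on smooth even functions. -/
theorem linearized_kdv_estimate_smooth {p q s : ℝ} (hp : 0 < p) (hq : 0 < q) (hs : 0 < s)
    (hpq : p = 4 * s ^ 2 * q) {w : ℝ →ᵇ ℝ} (hw : ∀ x, w x = 12 * s ^ 2 * q / Real.cosh (s * x) ^ 2)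
    {g : ℝ → ℝ} (hc : HasCompactSupport g) (hsm : ContDiff ℝ ∞ g) (hev : ∀ x, g (-x) = g x)
    {u : L2} (hu : u =ᵐ[volume] g) :
    ‖u‖ ≤ (1 + 120 * s * ‖(memLp_inv_cosh hs).toLp _‖ ^ 2) *
      ‖fourierL2 u - mulC (resolventSymbol p q hp hq) (fourierL2 (mulOp w u))‖ := by
  have hwfun : (w : ℝ → ℝ) = fun x => 12 * s ^ 2 * q / Real.cosh (s * x) ^ 2 := funext hw
  have hcw : ContDiff ℝ ∞ (fun x => w x * g x) := by
    refine ContDiff.mul ?_ hsm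
    rw [hwfun]
    refine contDiff_const.div ?_ fun x => (pow_pos (Real.cosh_pos _) 2).ne'
    exact (Real.contDiff_cosh.comp (contDiff_const.mul contDiff_id)).pow 2
  obtain ⟨φ, hφ⟩ := ofReal_comp_smooth hc hsm
  obtain ⟨h, hh⟩ := ofReal_comp_smooth (g := fun x => w x * g x) hc.mul_left hcw
  obtain ⟨θ, hθF, hθd, hθe⟩ := exists_schwartz_resolvent hp hq h (fun x => by
    rw [hh, hh, hev, hw, hw, mul_neg, Real.cosh_neg])
  set G := (memLp_inv_cosh hs).toLp _ with hG
  set f : 𝓢(ℝ, ℂ) := φ - θ with hf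
  -- the right hand side is the norm of `f`
  have hnorm : ‖fourierL2 u - mulC (resolventSymbol p q hp hq) (fourierL2 (mulOp w u))‖
      = ‖f.toLp 2 (volume : Measure ℝ)‖ := by
    have h1 := fourierL2_coeFn_of_schwartz (f := u) (φ := φ) (hu.mono fun x hx => by rw [hx, hφ])
    have h2 := fourierL2_coeFn_of_schwartz (f := mulOp w u) (φ := h) (by
      filter_upwards [hu, mulOp_coeFn w u] with x h1 h2
      rw [h2, h1, hh])
    have h3 : fourierL2 u - mulC (resolventSymbol p q hp hq) (fourierL2 (mulOp w u))
        = 𝓕 (f.toLp 2 (volume : Measure ℝ)) := by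
      rw [SchwartzMap.toLp_fourier_eq]
      refine Lp.ext ?_
      filter_upwards [h1, h2, mulC_coeFn (resolventSymbol p q hp hq) (fourierL2 (mulOp w u)),
        Lp.coeFn_sub (fourierL2 u)
          (mulC (resolventSymbol p q hp hq) (fourierL2 (mulOp w u))),
        (𝓕 f).coeFn_toLp 2 volume] with ξ e1 e2 e3 e4 e5
      rw [e4, e5, Pi.sub_apply, e3, e1, e2, hf, fourier_sub_schwartz,
        sub_apply, hθF]
      rfl
    rw [h3, Lp.norm_fourier_eq]
  rw [hnorm]
  have hE := fun a b (hab : a ≤ b) => integral_norm_div_cosh_le hs f hab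
  set E := ‖f.toLp 2 (volume : Measure ℝ)‖ * ‖G‖ with hEdef
  set θ' := SchwartzMap.derivCLM ℝ ℂ θ with hθ'
  have hd1 : ∀ x, HasDerivAt θ (θ' x) x := fun x => θ.hasDerivAt x
  have hd2 : ∀ x, HasDerivAt θ' (SchwartzMap.derivCLM ℝ ℂ θ' x) x := fun x => θ'.hasDerivAt x
  have h0 : θ' 0 = 0 := by
    have h1 : HasDerivAt (fun x => θ (-x)) (-(θ' 0)) 0 := by
      have := (hd1 (-0)).scomp (0 : ℝ) (hasDerivAt_neg (0 : ℝ))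
      simpa [Function.comp_def] using this
    have h2 : HasDerivAt (fun x => θ (-x)) (θ' 0) 0 := by
      simp only [hθe]; exact hd1 0
    have h3 := h1.unique h2
    linear_combination -(1 / 2) * h3
  have hlim : ∀ v : 𝓢(ℝ, ℂ), Tendsto v atTop (𝓝 0) := fun v =>
    v.tendsto_cocompact.mono_left atTop_le_cocompact
  have hq' : (q : ℂ) ≠ 0 := by exact_mod_cast hq.ne'
  have hpos : ∀ x, 0 ≤ x → ‖θ x‖ ≤ 120 * s * E / Real.cosh (s * x) := fun x hx =>
    norm_le_of_linearized_kdv hs f.continuous hE hd1 (fun x => (hd2 x).congr_deriv (by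
      have hcx : (Real.cosh (s * x) : ℂ) ≠ 0 := by exact_mod_cast (Real.cosh_pos _).ne'
      rw [hθd, hh, hf, sub_apply, hφ, hw, hpq]
      push_cast
      push_cast at hcx
      field_simp
      ring)) h0 (hlim θ) (hlim θ') hx
  have hall : ∀ x, ‖θ x‖ ≤ 120 * s * E * ‖1 / Real.cosh (s * x)‖ := fun x => by
    rw [Real.norm_of_nonneg (by positivity), mul_one_div]
    rcases le_total 0 x with hx | hx
    · exact hpos x hx
    · have := hpos (-x) (by linarith)
      rwa [hθe, mul_neg, Real.cosh_neg] at this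
  have hθn : ‖θ.toLp 2 (volume : Measure ℝ)‖ ≤ 120 * s * E * ‖G‖ := by
    refine Lp.norm_le_mul_norm_of_ae_le_mul ?_
    filter_upwards [θ.coeFn_toLp 2 volume, (memLp_inv_cosh hs).coeFn_toLp] with x e1 e2
    rw [e1, hG, e2]
    exact hall x
  have hun : ‖u‖ = ‖f.toLp 2 (volume : Measure ℝ) + θ.toLp 2 (volume : Measure ℝ)‖ := by
    rw [← complexify.norm_map u]
    congr 1
    refine Lp.ext ?_
    filter_upwards [complexify_coeFn u, hu, f.coeFn_toLp 2 volume, θ.coeFn_toLp 2 volume,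
      Lp.coeFn_add (f.toLp 2 (volume : Measure ℝ)) (θ.toLp 2 (volume : Measure ℝ))]
      with x e1 e2 e3 e4 e5
    rw [e1, e2, e5, Pi.add_apply, e3, e4, hf, sub_apply, hφ]
    ring
  rw [hun]
  refine (norm_add_le _ _).trans ((add_le_add_right hθn _).trans (le_of_eq ?_))
  rw [hEdef]
  ring

theorem measurePreserving_neg_real : MeasurePreserving (fun x : ℝ => -x) volume volume :=
  Measure.measurePreserving_neg volume

/-- The reflection `f ↦ f (-·)` on `L²(ℝ)`. -/
noncomputable def reflect : L2 →L[ℝ] L2 :=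
  (Lp.compMeasurePreservingₗᵢ ℝ (fun x : ℝ => -x)
    measurePreserving_neg_real).toContinuousLinearMap

theorem reflect_coeFn (f : L2) : reflect f =ᵐ[volume] fun x => f (-x) :=
  Lp.coeFn_compMeasurePreserving f measurePreserving_neg_real

theorem mem_evenL2_iff_reflect {f : L2} : f ∈ evenL2 ↔ reflect f = f := by
  rw [mem_evenL2]
  constructor
  · intro h
    refine Lp.ext ?_
    filter_upwards [reflect_coeFn f, h] with x h1 h2
    rw [h1, h2]
  · intro h
    have h1 := reflect_coeFn f
    rw [h] at h1
    filter_upwards [h1] with x h1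
    exact h1.symm

theorem isClosed_evenL2 : IsClosed (evenL2 : Set L2) := by
  have : (evenL2 : Set L2) = {f | reflect f = f} := Set.ext fun f => mem_evenL2_iff_reflect
  rw [this]
  exact isClosed_eq reflect.continuous continuous_id

/-- The linearized KdV operator is bounded below on even functions: its kernel is spanned by the
odd function `W_*'`. -/
theorem linearized_kdv_estimate {p q s : ℝ} (hp : 0 < p) (hq : 0 < q) (hs : 0 < s)
    (hpq : p = 4 * s ^ 2 * q) {w : ℝ →ᵇ ℝ}
    (hw : ∀ x, w x = 12 * s ^ 2 * q / Real.cosh (s * x) ^ 2) :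
    ∃ C, 0 ≤ C ∧ ∀ u ∈ evenL2, ‖u‖ ≤ C *
      ‖fourierL2 u - mulC (resolventSymbol p q hp hq) (fourierL2 (mulOp w u))‖ := by
  refine ⟨1 + 120 * s * ‖(memLp_inv_cosh hs).toLp _‖ ^ 2, by positivity, fun u hu => ?_⟩
  set C := 1 + 120 * s * ‖(memLp_inv_cosh hs).toLp _‖ ^ 2 with hC
  -- symmetrization reduces the estimate to a dense set of even functions
  set S : L2 →L[ℝ] L2 := (1 / 2 : ℝ) • (ContinuousLinearMap.id ℝ L2 + reflect) with hS
  have hSu : S u = u := by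
    rw [mem_evenL2_iff_reflect] at hu
    simp only [hS, smul_apply, add_apply, ContinuousLinearMap.id_apply, hu]
    rw [← two_smul ℝ, smul_smul]
    norm_num
  have hcl : IsClosed {v : L2 | ‖S v‖ ≤ C *
      ‖fourierL2 (S v) - mulC (resolventSymbol p q hp hq) (fourierL2 (mulOp w (S v)))‖} := by
    refine isClosed_le S.continuous.norm (continuous_const.mul (Continuous.norm ?_))
    exact (fourierL2.continuous.comp S.continuous).sub ((mulC _).continuous.comp
      (fourierL2.continuous.comp ((mulOp w).continuous.comp S.continuous)))
  have hmem : u ∈ {v : L2 | ‖S v‖ ≤ C *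
      ‖fourierL2 (S v) - mulC (resolventSymbol p q hp hq) (fourierL2 (mulOp w (S v)))‖} := by
    refine (hcl.closure_subset_iff.2 ?_) (dense_smooth u)
    rintro v ⟨g, hvg, hc, hsm⟩
    have hcneg : HasCompactSupport fun x => g (-x) :=
      hc.comp_homeomorph (Homeomorph.neg ℝ)
    refine linearized_kdv_estimate_smooth hp hq hs hpq hw
      (g := fun x => 1 / 2 * (g x + g (-x))) ((hc.add hcneg).mul_left)
      (contDiff_const.mul (hsm.add (hsm.comp contDiff_neg))) (fun x => by rw [neg_neg]; ring) ?_
    have hvg' := measurePreserving_neg_real.quasiMeasurePreserving.ae hvg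
    have e0 : S v = (1 / 2 : ℝ) • (v + reflect v) := rfl
    rw [e0]
    filter_upwards [hvg, hvg', reflect_coeFn v, Lp.coeFn_smul (1 / 2 : ℝ) (v + reflect v),
      Lp.coeFn_add v (reflect v)] with x e1 e2 e3 e4 e5
    rw [e4, Pi.smul_apply, e5, Pi.add_apply, e3, e1, e2, smul_eq_mul]
  rw [Set.mem_ofPred_eq, hSu] at hmem
  exact hmem

/-! ### Bounds for the symbols -/

theorem abs_sinc_sub_le (u : ℝ) : |Real.sinc u - (1 - u ^ 2 / 6)| ≤ 3 * |u| ^ 3 := by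
  rcases le_total |u| 1 with h | h
  · rcases eq_or_ne u 0 with rfl | hu
    · simp
    have h1 := Real.sin_bound h
    have hu' : 0 < |u| := abs_pos.2 hu
    have e : Real.sinc u - (1 - u ^ 2 / 6) = (Real.sin u - (u - u ^ 3 / 6)) / u := by
      rw [Real.sinc_of_ne_zero hu]; field_simp
    rw [e, abs_div, div_le_iff₀ hu']
    refine h1.trans ?_
    have : 0 ≤ |u| ^ 4 := by positivity
    nlinarith
  · have h1 := Real.abs_sinc_le_one u
    have h2 : 1 ≤ |u| ^ 2 := one_le_pow₀ h
    have h3 : |u| ^ 2 ≤ |u| ^ 3 := pow_le_pow_right₀ h (by norm_num)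
    rw [sq_abs] at h2 h3
    rw [abs_le] at h1 ⊢
    constructor <;> linarith [h1.1, h1.2]

theorem abs_one_sub_sinc_sq_sub_le (u : ℝ) :
    |1 - Real.sinc u ^ 2 - u ^ 2 / 3| ≤ 22 * |u| ^ 3 := by
  have h := abs_sinc_sub_le u
  have hs : (1 - Real.sinc u) ^ 2 ≤ 16 * |u| ^ 3 := by
    rcases le_total |u| 1 with h1 | h1
    · have h3 : |u| ^ 3 ≤ |u| ^ 2 := pow_le_pow_of_le_one (abs_nonneg u) h1 (by norm_num)
      have h4 : |u| ^ 4 ≤ |u| ^ 3 := pow_le_pow_of_le_one (abs_nonneg u) h1 (by norm_num)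
      have h5 : |1 - Real.sinc u| ≤ 4 * |u| ^ 2 := by
        rw [sq_abs] at *
        rw [abs_le] at h ⊢
        constructor <;> nlinarith [h.1, h.2, sq_nonneg u]
      calc (1 - Real.sinc u) ^ 2 = |1 - Real.sinc u| ^ 2 := (sq_abs _).symm
        _ ≤ (4 * |u| ^ 2) ^ 2 := pow_le_pow_left₀ (abs_nonneg _) h5 2
        _ = 16 * |u| ^ 4 := by ring
        _ ≤ _ := by linarith
    · have h2 : 1 ≤ |u| ^ 3 := one_le_pow₀ h1
      have h3 := abs_le.1 (Real.abs_sinc_le_one u)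
      nlinarith [h3.1, h3.2]
  have e : 1 - Real.sinc u ^ 2 - u ^ 2 / 3
      = -2 * (Real.sinc u - (1 - u ^ 2 / 6)) - (1 - Real.sinc u) ^ 2 := by ring
  rw [e]
  have := sq_nonneg (1 - Real.sinc u)
  rw [abs_le] at h ⊢
  constructor <;> linarith [h.1, h.2]

theorem one_sub_sinc_sq_nonneg (u : ℝ) : 0 ≤ 1 - Real.sinc u ^ 2 := by
  have h := abs_le.1 (Real.abs_sinc_le_one u)
  nlinarith [h.1, h.2]

theorem one_sub_sinc_sq_le (u : ℝ) : 1 - Real.sinc u ^ 2 ≤ 23 * u ^ 2 := by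
  rcases le_total |u| 1 with h1 | h1
  · have h3 : |u| ^ 3 ≤ |u| ^ 2 := pow_le_pow_of_le_one (abs_nonneg u) h1 (by norm_num)
    have h := abs_le.1 (abs_one_sub_sinc_sq_sub_le u)
    rw [sq_abs] at h3
    nlinarith [h.2, sq_nonneg u]
  · have h2 : 1 ≤ |u| ^ 2 := one_le_pow₀ h1
    rw [sq_abs] at h2
    nlinarith [sq_nonneg (Real.sinc u)]

set_option maxHeartbeats 800000 in
/-- The inverse of the `2 × 2` symbol of `ℬ_ε`, by Cramer's rule. In the lemma, `D` is the rank one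
matrix `δ (-λ, 1)ᵀ (-λ, 1)`, `p` is the perturbation at the scaled frequency `x = ε y`, and
`ε² + D + p` is the symbol of `ε² ℬ_ε^can`. Up to small errors, the solution is the multiple
`1 / (1 + λ² + a y²)` of the kernel vector `(1, λ)` of `D`. -/
theorem symbol_estimate {lam δ a A δ₁ : ℝ} (hδ : 0 < δ) (ha : 0 < a) (hA : 0 ≤ A) (hδ₁ : 0 < δ₁) :
    ∃ ε₀ > 0, ∃ C ≥ 0, ∀ ε : ℝ, 0 < ε → ε < ε₀ → ∀ x n p₁₁ p₁₂ p₂₂ : ℝ,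
      0 ≤ n → n ≤ 2 → n ≤ |x| → |p₁₁| ≤ A * n ^ 2 → |p₁₂| ≤ A * n ^ 2 → |p₂₂| ≤ A * n ^ 2 →
      |a * x ^ 2 - (p₁₁ + 2 * lam * p₁₂ + lam ^ 2 * p₂₂)| ≤ A * n * x ^ 2 →
      δ₁ * n ^ 2 ≤ (lam ^ 2 * δ + p₁₁) * (δ + p₂₂) - (-(lam * δ) + p₁₂) ^ 2 →
      ∀ v₁ v₂ g₁ g₂ m₁ m₂ : ℂ,
      (((ε ^ 2 + lam ^ 2 * δ + p₁₁ : ℝ) : ℂ) * v₁ + ((-(lam * δ) + p₁₂ : ℝ) : ℂ) * v₂)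
        + lam * (((-(lam * δ) + p₁₂ : ℝ) : ℂ) * v₁ + ((ε ^ 2 + δ + p₂₂ : ℝ) : ℂ) * v₂)
        = (ε : ℂ) ^ 2 * (g₁ + m₁) →
      ((-(lam * δ) + p₁₂ : ℝ) : ℂ) * v₁ + ((ε ^ 2 + δ + p₂₂ : ℝ) : ℂ) * v₂ = g₂ + m₂ →
      ‖v₁ - ((1 / (1 + lam ^ 2 + a * (x / ε) ^ 2) : ℝ) : ℂ) * m₁‖
          ≤ C * (‖g₁‖ + ‖g₂‖ + ‖m₂‖ + ε * ‖m₁‖) ∧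
      ‖v₂ - (lam : ℂ) * (((1 / (1 + lam ^ 2 + a * (x / ε) ^ 2) : ℝ) : ℂ) * m₁)‖
          ≤ C * (‖g₁‖ + ‖g₂‖ + ‖m₂‖ + ε * ‖m₁‖) := by
  set c := min δ (δ₁ / 2) with hc
  have hcpos : 0 < c := lt_min hδ (by positivity)
  set a₀ := min 1 a with ha₀
  have ha₀pos : 0 < a₀ := lt_min one_pos ha
  set B := 1 + (1 + |lam|) * δ + 4 * A with hB
  have hBpos : 0 < B := by positivity
  set K := (1 + |lam|) * (1 + A) with hK
  have hKpos : 0 < K := by positivity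
  refine ⟨min 1 (δ₁ / (4 * A + 1)), by positivity,
    (B + K) * (1 + A / a₀ + K / a₀) / c, by positivity, ?_⟩
  intro ε hε hε₀ x n p₁₁ p₁₂ p₂₂ hn0 hn2 hnx hp₁₁ hp₁₂ hp₂₂ hQ hT v₁ v₂ g₁ g₂ m₁ m₂ e₁ e₂
  have hε1 : ε ≤ 1 := (hε₀.trans_le (min_le_left _ _)).le
  have hε2 : ε * (4 * A + 1) ≤ δ₁ := by
    have := (hε₀.trans_le (min_le_right _ _)).le
    rwa [le_div_iff₀ (by positivity)] at this
  have hεsq : ε ^ 2 ≤ ε := by nlinarith only [hε, hε1]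
  have hn4 : n ^ 2 ≤ 4 := by nlinarith only [hn0, hn2]
  have hnx2 : n ^ 2 ≤ x ^ 2 := by rw [← sq_abs x]; exact pow_le_pow_left₀ hn0 hnx 2
  obtain ⟨hp₁₁l, hp₁₁u⟩ := abs_le.1 hp₁₁
  obtain ⟨hp₂₂l, hp₂₂u⟩ := abs_le.1 hp₂₂
  have hAn : 0 ≤ A * n ^ 2 := by positivity
  set H₁₁ := ε ^ 2 + lam ^ 2 * δ + p₁₁ with hH₁₁
  set H₁₂ := -(lam * δ) + p₁₂ with hH₁₂
  set H₂₂ := ε ^ 2 + δ + p₂₂ with hH₂₂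
  set det := H₁₁ * H₂₂ - H₁₂ ^ 2 with hdet
  set N := ε ^ 2 + n ^ 2 with hN
  have hNpos : 0 < N := by positivity
  have hdetb : c * N ≤ det := by
    have h1 : det = ε ^ 4 + ε ^ 2 * (δ * (1 + lam ^ 2) + p₁₁ + p₂₂) +
        ((lam ^ 2 * δ + p₁₁) * (δ + p₂₂) - (-(lam * δ) + p₁₂) ^ 2) := by
      simp only [hdet, hH₁₁, hH₁₂, hH₂₂]; ring
    have h2 : ε ^ 2 * (2 * A) ≤ δ₁ / 2 := by
      have := mul_le_mul_of_nonneg_right hεsq hA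
      linarith only [this, hε2, hε]
    have h3 : c * n ^ 2 ≤ δ₁ / 2 * n ^ 2 := mul_le_mul_of_nonneg_right (min_le_right _ _)
      (sq_nonneg _)
    have h4 : c * ε ^ 2 ≤ δ * ε ^ 2 := mul_le_mul_of_nonneg_right (min_le_left _ _)
      (sq_nonneg _)
    have h5 : ε ^ 2 * (δ - 2 * (A * n ^ 2)) ≤ ε ^ 2 * (δ * (1 + lam ^ 2) + p₁₁ + p₂₂) := by
      refine mul_le_mul_of_nonneg_left ?_ (sq_nonneg _)
      have : 0 ≤ δ * lam ^ 2 := by positivity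
      linarith
    have h6 := mul_le_mul_of_nonneg_right h2 (sq_nonneg n)
    have h7 : 0 ≤ ε ^ 4 := by positivity
    rw [h1, hN]
    linarith only [h3, h4, h5, h6, h7, hT]
  have hdetpos : 0 < det := (mul_pos hcpos hNpos).trans_le hdetb
  set κ := 1 / (1 + lam ^ 2 + a * (x / ε) ^ 2) with hκ
  have hκ0 : 0 ≤ κ := by positivity
  have hκeq : κ * ((1 + lam ^ 2) * ε ^ 2 + a * x ^ 2) = ε ^ 2 := by
    rw [hκ]; field_simp
  have hκb : κ * (ε ^ 2 + x ^ 2) ≤ ε ^ 2 / a₀ := by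
    rw [le_div_iff₀ ha₀pos, mul_assoc]
    refine le_trans (mul_le_mul_of_nonneg_left ?_ hκ0) hκeq.le
    have h1 : a₀ * ε ^ 2 ≤ 1 * ε ^ 2 := mul_le_mul_of_nonneg_right (min_le_left _ _) (sq_nonneg _)
    have h2 : a₀ * x ^ 2 ≤ a * x ^ 2 := mul_le_mul_of_nonneg_right (min_le_right _ _) (sq_nonneg _)
    have h3 : 0 ≤ lam ^ 2 * ε ^ 2 := by positivity
    linarith only [h1, h2, h3]
  -- the residuals of the approximate solution `κ m₁ (1, λ)`
  set ρ₁ := κ * (a * x ^ 2 - (p₁₁ + 2 * lam * p₁₂ + lam ^ 2 * p₂₂)) with hρ₁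
  set s₁ := ε ^ 2 + p₁₁ + lam * p₁₂ with hs₁
  set s₂ := lam * ε ^ 2 + lam * p₂₂ + p₁₂ with hs₂
  have hρ₁b : |ρ₁| ≤ A / a₀ * ε * N := by
    rw [hρ₁, abs_mul, abs_of_nonneg hκ0]
    calc κ * |a * x ^ 2 - (p₁₁ + 2 * lam * p₁₂ + lam ^ 2 * p₂₂)|
        ≤ κ * (A * n * x ^ 2) := mul_le_mul_of_nonneg_left hQ hκ0
      _ ≤ A * n * (κ * (ε ^ 2 + x ^ 2)) := by
          have : 0 ≤ κ * (A * n) * ε ^ 2 := by positivity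
          linarith only [this]
      _ ≤ A * n * (ε ^ 2 / a₀) := mul_le_mul_of_nonneg_left hκb (by positivity)
      _ = A / a₀ * ε * (ε * n) := by ring
      _ ≤ A / a₀ * ε * N := by
          refine mul_le_mul_of_nonneg_left ?_ (by positivity)
          rw [hN]
          nlinarith only [sq_nonneg (ε - n), sq_nonneg ε, sq_nonneg n]
  have hl := abs_nonneg lam
  have hsb : ∀ r₁ r₂ r₃ : ℝ, |r₁| ≤ A * n ^ 2 → |r₂| ≤ A * n ^ 2 → |r₃| ≤ 1 + |lam| →
      |r₃ * ε ^ 2 + r₁ + lam * r₂| ≤ K * N := by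
    intro r₁ r₂ r₃ h1 h2 h3
    calc |r₃ * ε ^ 2 + r₁ + lam * r₂| ≤ |r₃ * ε ^ 2| + |r₁| + |lam * r₂| :=
          abs_add_three _ _ _
      _ = |r₃| * ε ^ 2 + |r₁| + |lam| * |r₂| := by
          rw [abs_mul, abs_mul, abs_of_nonneg (sq_nonneg ε)]
      _ ≤ (1 + |lam|) * ε ^ 2 + A * n ^ 2 + |lam| * (A * n ^ 2) := by gcongr
      _ ≤ K * N := by
          rw [hK, hN]
          have h4 : 0 ≤ (1 + |lam|) * A * ε ^ 2 := by positivity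
          have h5 : 0 ≤ (1 + |lam|) * n ^ 2 := by positivity
          linarith only [h4, h5]
  have hs₁b : |s₁| ≤ K * N := by
    have := hsb p₁₁ p₁₂ 1 hp₁₁ hp₁₂ (by rw [abs_one]; linarith)
    rwa [one_mul] at this
  have hs₂b : |s₂| ≤ K * N := by
    have h1 := hsb p₁₂ p₂₂ lam hp₁₂ hp₂₂ (by linarith)
    have h2 : s₂ = lam * ε ^ 2 + p₁₂ + lam * p₂₂ := by rw [hs₂]; ring
    rwa [h2]
  have hκs₂ : |κ * s₂| ≤ K / a₀ * ε := by
    rw [abs_mul, abs_of_nonneg hκ0]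
    calc κ * |s₂| ≤ κ * (K * N) := mul_le_mul_of_nonneg_left hs₂b hκ0
      _ ≤ κ * (K * (ε ^ 2 + x ^ 2)) := by
          refine mul_le_mul_of_nonneg_left (mul_le_mul_of_nonneg_left ?_ hKpos.le) hκ0
          linarith
      _ = K * (κ * (ε ^ 2 + x ^ 2)) := by ring
      _ ≤ K * (ε ^ 2 / a₀) := mul_le_mul_of_nonneg_left hκb hKpos.le
      _ ≤ K / a₀ * ε := by
          rw [div_mul_eq_mul_div, mul_div_assoc]
          exact mul_le_mul_of_nonneg_left (by gcongr) hKpos.le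
  have hHb : |H₂₂| ≤ B ∧ |H₁₂| ≤ B := by
    have hA4 : A * n ^ 2 ≤ 4 * A := by nlinarith only [hA, hn4]
    have hld : 0 ≤ |lam| * δ := by positivity
    have hε21 : ε ^ 2 ≤ 1 := hεsq.trans hε1
    constructor
    · rw [abs_le]
      constructor <;> linarith only [sq_nonneg ε, hB, hH₂₂, hld, hε21, hp₂₂l, hp₂₂u, hA4, hδ, hAn]
    · have h1 : |H₁₂| ≤ |lam| * δ + |p₁₂| := by
        rw [hH₁₂]
        refine (abs_add_le _ _).trans (le_of_eq ?_)
        rw [abs_neg, abs_mul, abs_of_pos hδ]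
      linarith
  have hκC : (κ : ℂ) * ((1 + (lam : ℂ) ^ 2) * (ε : ℂ) ^ 2 + a * (x : ℂ) ^ 2) = (ε : ℂ) ^ 2 := by
    exact_mod_cast congrArg (fun r : ℝ => (r : ℂ)) hκeq
  set M := ‖g₁‖ + ‖g₂‖ + ‖m₂‖ + ε * ‖m₁‖ with hM
  have hfin : ∀ (e : ℂ) (h s : ℝ), |h| ≤ B → |s| ≤ K * N →
      (det : ℂ) * e = h * ((ε : ℂ) ^ 2 * g₁ + ρ₁ * m₁)
        + s * (g₂ + m₂ - ((κ * s₂ : ℝ) : ℂ) * m₁) →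
      ‖e‖ ≤ (B + K) * (1 + A / a₀ + K / a₀) / c * M := by
    intro e h s hh hs he
    have hm := norm_nonneg m₁
    have hg1 := norm_nonneg g₁
    have hg2 := norm_nonneg g₂
    have hm2 := norm_nonneg m₂
    have h1 : ‖(ε : ℂ) ^ 2 * g₁ + ρ₁ * m₁‖ ≤ N * (1 + A / a₀) * M := by
      calc ‖(ε : ℂ) ^ 2 * g₁ + ρ₁ * m₁‖ ≤ ε ^ 2 * ‖g₁‖ + |ρ₁| * ‖m₁‖ := by
            refine (norm_add_le _ _).trans (le_of_eq ?_)
            rw [norm_mul, norm_mul, norm_pow, Complex.norm_real, Complex.norm_real,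
              Real.norm_of_nonneg hε.le, Real.norm_eq_abs]
        _ ≤ N * M + A / a₀ * ε * N * ‖m₁‖ := by
            refine add_le_add (mul_le_mul ?_ ?_ hg1 hNpos.le) (mul_le_mul_of_nonneg_right hρ₁b hm)
            · rw [hN]; linarith [sq_nonneg n]
            · rw [hM]; have := mul_nonneg hε.le hm; linarith
        _ = N * M + (A / a₀ * N) * (ε * ‖m₁‖) := by ring
        _ ≤ N * M + (A / a₀ * N) * M := by
            gcongr
            rw [hM]; linarith
        _ = _ := by ring
    have h2 : ‖g₂ + m₂ - ((κ * s₂ : ℝ) : ℂ) * m₁‖ ≤ (1 + K / a₀) * M := by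
      calc ‖g₂ + m₂ - ((κ * s₂ : ℝ) : ℂ) * m₁‖ ≤ (‖g₂‖ + ‖m₂‖) + |κ * s₂| * ‖m₁‖ := by
            refine (norm_sub_le _ _).trans (add_le_add (norm_add_le _ _) (le_of_eq ?_))
            rw [norm_mul, Complex.norm_real, Real.norm_eq_abs]
        _ ≤ M + K / a₀ * ε * ‖m₁‖ := by
            refine add_le_add ?_ (mul_le_mul_of_nonneg_right hκs₂ hm)
            rw [hM]; have := mul_nonneg hε.le hm; linarith
        _ = M + K / a₀ * (ε * ‖m₁‖) := by ring
        _ ≤ M + K / a₀ * M := by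
            gcongr
            rw [hM]; linarith
        _ = _ := by ring
    have h3 : det * ‖e‖ ≤ B * (N * (1 + A / a₀) * M) + K * N * ((1 + K / a₀) * M) := by
      have h4 : det * ‖e‖ = ‖(det : ℂ) * e‖ := by
        rw [norm_mul, Complex.norm_real, Real.norm_of_nonneg hdetpos.le]
      rw [h4, he]
      refine (norm_add_le _ _).trans (add_le_add ?_ ?_)
      · rw [norm_mul, Complex.norm_real]
        exact mul_le_mul hh h1 (norm_nonneg _) hBpos.le
      · rw [norm_mul, Complex.norm_real]
        exact mul_le_mul hs h2 (norm_nonneg _) (by positivity)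
    have hMpos : 0 ≤ M := by positivity
    have h5 : c * N * ‖e‖ ≤ det * ‖e‖ := mul_le_mul_of_nonneg_right hdetb (norm_nonneg _)
    have h6 : B * (N * (1 + A / a₀) * M) + K * N * ((1 + K / a₀) * M)
        ≤ N * ((B + K) * (1 + A / a₀ + K / a₀) * M) := by
      have q1 : 0 ≤ N * M * (B * (K / a₀)) := by positivity
      have q2 : 0 ≤ N * M * (K * (A / a₀)) := by positivity
      linarith
    rw [div_mul_eq_mul_div, le_div_iff₀ hcpos]
    refine le_of_mul_le_mul_left ?_ hNpos
    linarith
  constructor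
  · refine hfin _ H₂₂ (-s₂) hHb.1 (by rwa [abs_neg]) ?_
    simp only [hdet, hρ₁, hs₂, hH₁₁, hH₁₂, hH₂₂] at e₁ e₂ ⊢
    push_cast at e₁ e₂ ⊢
    linear_combination ((ε : ℂ) ^ 2 + δ + p₂₂) * e₁
      - (lam * (ε : ℂ) ^ 2 + lam * p₂₂ + p₁₂) * e₂ - ((ε : ℂ) ^ 2 + δ + p₂₂) * m₁ * hκC
  · refine hfin _ (-H₁₂) s₁ (by rw [abs_neg]; exact hHb.2) hs₁b ?_
    simp only [hdet, hρ₁, hs₁, hs₂, hH₁₁, hH₁₂, hH₂₂] at e₁ e₂ ⊢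
    push_cast at e₁ e₂ ⊢
    linear_combination (-(-(lam * δ : ℂ) + p₁₂)) * e₁
      + ((ε : ℂ) ^ 2 + p₁₁ + lam * p₁₂) * e₂ + (-(lam * δ : ℂ) + p₁₂) * m₁ * hκC

/-! ### The symbol of the operator matrix -/

theorem S_nonneg (k x : ℝ) : 0 ≤ Coeffs.S k x := one_sub_sinc_sq_nonneg _

theorem S_le_one (k x : ℝ) : Coeffs.S k x ≤ 1 := by
  rw [Coeffs.S]
  linarith [sq_nonneg (Real.sinc (k * x / 2))]

theorem S_le (k x : ℝ) : Coeffs.S k x ≤ (1 + 6 * k ^ 2) * (min |x| 2) ^ 2 := by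
  rcases le_total |x| 2 with h | h
  · rw [min_eq_left h, sq_abs]
    have := one_sub_sinc_sq_le (k * x / 2)
    rw [Coeffs.S]
    nlinarith [sq_nonneg x, sq_nonneg (k * x)]
  · rw [min_eq_right h]
    have := S_le_one k x
    nlinarith [sq_nonneg k]

theorem abs_S_sub_le (k x : ℝ) :
    |Coeffs.S k x - k ^ 2 / 12 * x ^ 2| ≤ (3 * |k| ^ 3 + 1 + k ^ 2) * (min |x| 2 * x ^ 2) := by
  rcases le_total |x| 2 with h | h
  · rw [min_eq_left h]
    have h1 := abs_one_sub_sinc_sq_sub_le (k * x / 2)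
    have e : Coeffs.S k x - k ^ 2 / 12 * x ^ 2
        = 1 - Real.sinc (k * x / 2) ^ 2 - (k * x / 2) ^ 2 / 3 := by rw [Coeffs.S]; ring
    rw [e]
    refine h1.trans ?_
    have h2 : |k * x / 2| ^ 3 = |k| ^ 3 * (|x| * x ^ 2) / 8 := by
      rw [abs_div, abs_mul, abs_of_pos (two_pos : (0 : ℝ) < 2), ← sq_abs x]
      ring
    rw [h2]
    have h3 : 0 ≤ |k| ^ 3 * (|x| * x ^ 2) := by positivity
    have h4 : 0 ≤ (1 + k ^ 2) * (|x| * x ^ 2) := by positivity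
    linarith
  · rw [min_eq_right h]
    have h1 := S_le_one k x
    have h2 := S_nonneg k x
    have h3 : 4 ≤ x ^ 2 := by rw [← sq_abs]; nlinarith
    have h4 : 0 ≤ |k| ^ 3 * x ^ 2 := by positivity
    have h5 : 0 ≤ k ^ 2 * x ^ 2 := by positivity
    rw [abs_le]
    constructor <;> linarith

namespace Coeffs

variable {M : ℕ} (P : Coeffs M)

/-- The `x`-dependent part of the symbol of `ε² ℬ_ε^can`, at the scaled frequency `x`. -/
noncomputable def pert (i j : Fin 2) (x : ℝ) : ℝ := ∑ m, P.k m ^ 2 * P.α m i j * S (P.k m) x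

theorem exists_pert_bound (i j : Fin 2) : ∃ A, 0 ≤ A ∧ ∀ x : ℝ,
    |P.pert i j x| ≤ A * (min |x| 2) ^ 2 ∧
    |P.pert i j x - (∑ m, P.k m ^ 4 / 12 * P.α m i j) * x ^ 2| ≤ A * (min |x| 2 * x ^ 2) := by
  refine ⟨∑ m, |P.k m ^ 2 * P.α m i j| *
      ((1 + 6 * P.k m ^ 2) + (3 * |P.k m| ^ 3 + 1 + P.k m ^ 2)),
    Finset.sum_nonneg fun m _ => by positivity, fun x => ⟨?_, ?_⟩⟩
  · rw [pert, Finset.sum_mul]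
    refine (Finset.abs_sum_le_sum_abs _ _).trans (Finset.sum_le_sum fun m _ => ?_)
    rw [abs_mul _ (S _ _), abs_of_nonneg (S_nonneg _ _), mul_assoc]
    refine mul_le_mul_of_nonneg_left ((S_le (P.k m) x).trans ?_) (abs_nonneg _)
    exact mul_le_mul_of_nonneg_right (le_add_of_nonneg_right (by positivity)) (sq_nonneg _)
  · have e : P.pert i j x - (∑ m, P.k m ^ 4 / 12 * P.α m i j) * x ^ 2
        = ∑ m, P.k m ^ 2 * P.α m i j * (S (P.k m) x - P.k m ^ 2 / 12 * x ^ 2) := by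
      rw [pert, Finset.sum_mul, ← Finset.sum_sub_distrib]
      exact Finset.sum_congr rfl fun m _ => by ring
    rw [e, Finset.sum_mul]
    refine (Finset.abs_sum_le_sum_abs _ _).trans (Finset.sum_le_sum fun m _ => ?_)
    rw [abs_mul _ (S _ _ - _), mul_assoc]
    refine mul_le_mul_of_nonneg_left ((abs_S_sub_le (P.k m) x).trans ?_) (abs_nonneg _)
    exact mul_le_mul_of_nonneg_right (le_add_of_nonneg_left (by positivity)) (by positivity)

variable {P}

/-- The coefficient of `-∂²` in the limit of the first row of `ℬ_ε`. -/
noncomputable def dispersion (P : Coeffs M) : ℝ :=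
  (P.a₁ + P.lam * P.a₂) + P.lam * (P.b₂ + P.lam * P.b₁)

theorem Generic.σ₀_sub_c₃_pos (h : P.Generic) : 0 < P.σ₀ - P.c₃ := by
  have h1 : |P.c₁ - P.c₃| < √((P.c₁ - P.c₃) ^ 2 + 4 * P.c₂ ^ 2) := by
    rw [← Real.sqrt_sq_eq_abs]
    refine Real.sqrt_lt_sqrt (sq_nonneg _) ?_
    have := sq_pos_of_ne_zero h.c₂_ne
    linarith
  have h2 := neg_abs_le (P.c₁ - P.c₃)
  rw [σ₀]
  linarith

theorem Generic.lam_mul (h : P.Generic) : P.lam * (P.σ₀ - P.c₃) = P.c₂ := by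
  rw [lam, div_mul_cancel₀ _ h.σ₀_sub_c₃_pos.ne']

theorem Generic.σ₀_sub_c₁ (h : P.Generic) : P.σ₀ - P.c₁ = P.lam ^ 2 * (P.σ₀ - P.c₃) := by
  have h1 := P.σ₀_eq
  rw [← h.lam_mul] at h1
  refine mul_right_cancel₀ h.σ₀_sub_c₃_pos.ne' ?_
  linear_combination h1

theorem Generic.dispersion_pos (h : P.Generic) : 0 < P.dispersion := by
  have h1 := h.d₁_pos
  rw [d₁] at h1
  exact (div_pos_iff_of_pos_left (by positivity)).1 h1

theorem Generic.d₁_mul (h : P.Generic) : P.d₁ * P.dispersion = 1 + P.lam ^ 2 :=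
  div_mul_cancel₀ _ h.dispersion_pos.ne'

theorem a₂_eq_b₂ (h : P.Symmetric) : P.a₂ = P.b₂ := by
  rw [a₂, b₂]
  exact Finset.sum_congr rfl fun m _ => by rw [h.α_symm]

/-- `T` is a positive multiple of the determinant of `D + pert`, where `D` is the rank one matrix
`σ₀ - (c₁, c₂; c₂, c₃)`. -/
theorem T_eq (h : P.Generic) (x : ℝ) :
    P.T x = ((1 + P.lam ^ 2) * (P.σ₀ - P.c₃)) *
      ((P.lam ^ 2 * (P.σ₀ - P.c₃) + P.pert 0 0 x) * ((P.σ₀ - P.c₃) + P.pert 1 1 x)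
        - (-(P.lam * (P.σ₀ - P.c₃)) + P.pert 0 1 x) ^ 2) := by
  have e : ∑ m, P.k m ^ 2 * ((P.σ₀ - P.c₃) * P.α m 0 0 + (P.σ₀ - P.c₁) * P.α m 1 1
      + 2 * P.c₂ * P.α m 0 1) * S (P.k m) x
      = (P.σ₀ - P.c₃) * P.pert 0 0 x + (P.σ₀ - P.c₁) * P.pert 1 1 x
        + 2 * P.c₂ * P.pert 0 1 x := by
    simp only [pert, Finset.mul_sum, ← Finset.sum_add_distrib]
    exact Finset.sum_congr rfl fun m _ => by ring
  have e2 : 2 * P.σ₀ - (P.c₁ + P.c₃) = (1 + P.lam ^ 2) * (P.σ₀ - P.c₃) := by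
    linear_combination h.σ₀_sub_c₁
  rw [T, e, e2, h.σ₀_sub_c₁, ← h.lam_mul]
  simp only [pert]
  ring

/-- The hypotheses of `symbol_estimate` hold for the symbol of `ℬ_ε`. -/
theorem exists_symbol_bounds (hs : P.Symmetric) (h : P.Generic) (hi : P.InversionCondition) :
    ∃ A δ₁, 0 ≤ A ∧ 0 < δ₁ ∧ ∀ x : ℝ,
      |P.pert 0 0 x| ≤ A * (min |x| 2) ^ 2 ∧ |P.pert 0 1 x| ≤ A * (min |x| 2) ^ 2 ∧
      |P.pert 1 1 x| ≤ A * (min |x| 2) ^ 2 ∧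
      |P.dispersion * x ^ 2 -
        (P.pert 0 0 x + 2 * P.lam * P.pert 0 1 x + P.lam ^ 2 * P.pert 1 1 x)|
          ≤ A * (min |x| 2) * x ^ 2 ∧
      δ₁ * (min |x| 2) ^ 2 ≤
        (P.lam ^ 2 * (P.σ₀ - P.c₃) + P.pert 0 0 x) * ((P.σ₀ - P.c₃) + P.pert 1 1 x)
        - (-(P.lam * (P.σ₀ - P.c₃)) + P.pert 0 1 x) ^ 2 := by
  obtain ⟨A₁, hA₁, h₁⟩ := P.exists_pert_bound 0 0
  obtain ⟨A₂, hA₂, h₂⟩ := P.exists_pert_bound 0 1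
  obtain ⟨A₃, hA₃, h₃⟩ := P.exists_pert_bound 1 1
  obtain ⟨δ₀, hδ₀, hT⟩ := hi
  have hδ := h.σ₀_sub_c₃_pos
  refine ⟨(1 + 2 * |P.lam| + P.lam ^ 2) * (A₁ + A₂ + A₃),
    δ₀ / ((1 + P.lam ^ 2) * (P.σ₀ - P.c₃)), by positivity, by positivity, fun x => ?_⟩
  set n := min |x| 2 with hn
  have hn0 : 0 ≤ n := le_min (abs_nonneg _) two_pos.le
  have hl := abs_nonneg P.lam
  have hA : ∀ A', 0 ≤ A' → A' ≤ A₁ + A₂ + A₃ →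
      A' * n ^ 2 ≤ (1 + 2 * |P.lam| + P.lam ^ 2) * (A₁ + A₂ + A₃) * n ^ 2 := fun A' h0 hA' => by
    refine mul_le_mul_of_nonneg_right ?_ (sq_nonneg _)
    have : 0 ≤ (2 * |P.lam| + P.lam ^ 2) * (A₁ + A₂ + A₃) := by positivity
    linarith
  refine ⟨(h₁ x).1.trans (hA _ hA₁ (by linarith)), (h₂ x).1.trans (hA _ hA₂ (by linarith)),
    (h₃ x).1.trans (hA _ hA₃ (by linarith)), ?_, ?_⟩
  · have e : P.dispersion * x ^ 2 -
        (P.pert 0 0 x + 2 * P.lam * P.pert 0 1 x + P.lam ^ 2 * P.pert 1 1 x)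
        = -(P.pert 0 0 x - P.a₁ * x ^ 2) - 2 * P.lam * (P.pert 0 1 x - P.a₂ * x ^ 2)
          - P.lam ^ 2 * (P.pert 1 1 x - P.b₁ * x ^ 2) := by
      rw [dispersion, ← a₂_eq_b₂ hs]; ring
    rw [e]
    have b₁ : |P.pert 0 0 x - P.a₁ * x ^ 2| ≤ A₁ * (n * x ^ 2) := (h₁ x).2
    have b₂ : |P.pert 0 1 x - P.a₂ * x ^ 2| ≤ A₂ * (n * x ^ 2) := (h₂ x).2
    have b₃ : |P.pert 1 1 x - P.b₁ * x ^ 2| ≤ A₃ * (n * x ^ 2) := (h₃ x).2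
    have hnx : 0 ≤ n * x ^ 2 := by positivity
    calc _ ≤ |P.pert 0 0 x - P.a₁ * x ^ 2| + 2 * |P.lam| * |P.pert 0 1 x - P.a₂ * x ^ 2|
          + P.lam ^ 2 * |P.pert 1 1 x - P.b₁ * x ^ 2| := by
          refine (abs_sub _ _).trans (add_le_add ((abs_sub _ _).trans (add_le_add ?_ ?_)) ?_)
          · rw [abs_neg]
          · rw [abs_mul, abs_mul, abs_two]
          · rw [abs_mul, abs_of_nonneg (sq_nonneg P.lam)]
      _ ≤ A₁ * (n * x ^ 2) + 2 * |P.lam| * (A₂ * (n * x ^ 2))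
          + P.lam ^ 2 * (A₃ * (n * x ^ 2)) := by gcongr
      _ ≤ _ := by
          have q₁ : 0 ≤ (A₂ + A₃) * (n * x ^ 2) := by positivity
          have q₂ : 0 ≤ 2 * |P.lam| * (A₁ + A₃) * (n * x ^ 2) := by positivity
          have q₃ : 0 ≤ P.lam ^ 2 * (A₁ + A₂) * (n * x ^ 2) := by positivity
          linarith
  · have h4 := hT x
    rw [T_eq h] at h4
    rw [div_mul_eq_mul_div, div_le_iff₀ (by positivity), mul_comm _ ((1 + P.lam ^ 2) * _)]
    exact h4

end Coeffs

/-! ### Operator bounds -/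

theorem coeFn_sum {ι : Type*} (s : Finset ι) (f : ι → L2C) :
    ((∑ i ∈ s, f i : L2C) : ℝ → ℂ) =ᵐ[volume] fun x => ∑ i ∈ s, f i x := by
  classical
  induction s using Finset.induction_on with
  | empty =>
    simp only [Finset.sum_empty]
    exact Lp.coeFn_zero ℂ 2 (volume : Measure ℝ)
  | insert i s hi ih =>
    rw [Finset.sum_insert hi]
    filter_upwards [Lp.coeFn_add (f i) (∑ i ∈ s, f i), ih] with x h1 h2
    rw [h1, Pi.add_apply, h2, Finset.sum_insert hi]

theorem Coeffs.fourierL2_Bcan {M : ℕ} (P : Coeffs M) {ε : ℝ} (hε : ε ≠ 0) (i j : Fin 2) (f : L2) :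
    fourierL2 (P.Bcan ε i j f) =ᵐ[volume] fun ξ =>
      (((1 / ε ^ 2) * ((if i = j then P.σ ε else 0) - (∑ m, P.k m ^ 2 * P.α m i j)
        + P.pert i j (ε * (2 * Real.pi * ξ))) : ℝ) : ℂ) * fourierL2 f ξ := by
  have hterm : ∀ m, fourierL2 ((P.k m ^ 2 * P.α m i j) • (avgOp (P.k m * ε) ^ 2) f) =ᵐ[volume]
      fun ξ => ((P.k m ^ 2 * P.α m i j * (1 - Coeffs.S (P.k m) (ε * (2 * Real.pi * ξ))) : ℝ) : ℂ)
        * fourierL2 f ξ := fun m => by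
    rcases eq_or_ne (P.k m) 0 with hk | hk
    · rw [hk]
      simp only [ne_eq, OfNat.ofNat_ne_zero, not_false_eq_true, zero_pow, zero_mul, zero_smul,
        map_zero, Complex.ofReal_zero]
      exact Lp.coeFn_zero ℂ 2 (volume : Measure ℝ)
    · have hη : P.k m * ε ≠ 0 := mul_ne_zero hk hε
      rw [map_smul, sq (avgOp _), mul_apply_eq_comp, fourierL2_avgOp hη,
        fourierL2_avgOp hη]
      filter_upwards [Lp.coeFn_smul (P.k m ^ 2 * P.α m i j) (mulC (sincBCF (P.k m * ε))
          (mulC (sincBCF (P.k m * ε)) (fourierL2 f))),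
        mulC_coeFn (sincBCF (P.k m * ε)) (mulC (sincBCF (P.k m * ε)) (fourierL2 f)),
        mulC_coeFn (sincBCF (P.k m * ε)) (fourierL2 f)] with ξ e1 e2 e3
      rw [e1, Pi.smul_apply, e2, e3, Complex.real_smul, sincBCF_apply, Coeffs.S]
      have : P.k m * (ε * (2 * Real.pi * ξ)) / 2 = Real.pi * (P.k m * ε) * ξ := by ring
      rw [this]
      push_cast
      ring
  have e : P.Bcan ε i j f = (1 / ε ^ 2) • ((if i = j then P.σ ε else 0) • f
      - ∑ m, (P.k m ^ 2 * P.α m i j) • (avgOp (P.k m * ε) ^ 2) f) := by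
    rw [Coeffs.Bcan]
    simp only [smul_apply, sub_apply, sum_apply, one_apply_eq_self]
  rw [e, map_smul, map_sub, map_sum, map_smul]
  set h : Fin M → L2C := fun m =>
    fourierL2 ((P.k m ^ 2 * P.α m i j) • (avgOp (P.k m * ε) ^ 2) f) with hh
  set c : ℝ := if i = j then P.σ ε else 0
  filter_upwards [Lp.coeFn_smul (1 / ε ^ 2) (c • fourierL2 f - ∑ m, h m),
    Lp.coeFn_sub (c • fourierL2 f) (∑ m, h m), Lp.coeFn_smul c (fourierL2 f),
    coeFn_sum Finset.univ h, ae_all_iff.2 hterm] with ξ e1 e2 e3 e4 e5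
  rw [e1, Pi.smul_apply, e2, Pi.sub_apply, e3, Pi.smul_apply, e4, Finset.sum_congr rfl
    fun m _ => e5 m, ← Finset.sum_mul, Complex.real_smul, Complex.real_smul, Coeffs.pert,
    ← Complex.ofReal_sum]
  have e6 : ∑ m, P.k m ^ 2 * P.α m i j * (1 - Coeffs.S (P.k m) (ε * (2 * Real.pi * ξ)))
      = (∑ m, P.k m ^ 2 * P.α m i j)
        - ∑ m, P.k m ^ 2 * P.α m i j * Coeffs.S (P.k m) (ε * (2 * Real.pi * ξ)) := by
    rw [← Finset.sum_sub_distrib]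
    exact Finset.sum_congr rfl fun m _ => by ring
  rw [e6]
  push_cast
  ring

theorem norm_avgOp_le (η : ℝ) (f : L2) : ‖avgOp η f‖ ≤ ‖f‖ := by
  refine ((avgOp η).le_of_opNorm_le ?_ f).trans (one_mul _).le
  exact LinearMap.mkContinuous_norm_le _ zero_le_one _

theorem norm_mulOp_le (w : ℝ →ᵇ ℝ) (f : L2) : ‖mulOp w f‖ ≤ ‖w‖ * ‖f‖ :=
  (mulOp w).le_of_opNorm_le (LinearMap.mkContinuous_norm_le _ (norm_nonneg _) _) f

theorem norm_mulC_le (b : ℝ →ᵇ ℝ) (f : L2C) : ‖mulC b f‖ ≤ ‖b‖ * ‖f‖ :=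
  (mulC b).le_of_opNorm_le (LinearMap.mkContinuous_norm_le _ (norm_nonneg _) _) f

theorem avgBCF_apply (η : ℝ) (w : ℝ →ᵇ ℝ) (x : ℝ) : avgBCF η w x = avg η w x := rfl

theorem norm_avgBCF_le (η : ℝ) (w : ℝ →ᵇ ℝ) : ‖avgBCF η w‖ ≤ ‖w‖ :=
  BoundedContinuousFunction.norm_ofNormedAddCommGroup_le _ (norm_nonneg _) _

theorem mulOp_sub (w₁ w₂ : ℝ →ᵇ ℝ) (f : L2) : mulOp (w₁ - w₂) f = mulOp w₁ f - mulOp w₂ f := by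
  refine Lp.ext ?_
  filter_upwards [mulOp_coeFn (w₁ - w₂) f, mulOp_coeFn w₁ f, mulOp_coeFn w₂ f,
    Lp.coeFn_sub (mulOp w₁ f) (mulOp w₂ f)] with x h1 h2 h3 h4
  rw [h1, h4, Pi.sub_apply, h2, h3, BoundedContinuousFunction.sub_apply]
  ring

theorem mulOp_smul (c : ℝ) (w : ℝ →ᵇ ℝ) (f : L2) : mulOp (c • w) f = c • mulOp w f := by
  refine Lp.ext ?_
  filter_upwards [mulOp_coeFn (c • w) f, mulOp_coeFn w f,
    Lp.coeFn_smul c (mulOp w f)] with x h1 h2 h3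
  rw [h1, h3, Pi.smul_apply, h2, BoundedContinuousFunction.smul_apply, smul_eq_mul, smul_eq_mul]
  ring

/-- Averaging a Lipschitz function changes it by `O(η)`. -/
theorem norm_avgBCF_sub_le {w : ℝ →ᵇ ℝ} {L : ℝ} (hL : 0 ≤ L)
    (hw : ∀ x y, |w x - w y| ≤ L * |x - y|) {η : ℝ} (hη : η ≠ 0) :
    ‖avgBCF η w - w‖ ≤ L * |η| := by
  refine (BoundedContinuousFunction.norm_le (by positivity)).2 fun x => ?_
  rw [BoundedContinuousFunction.sub_apply, avgBCF_apply, avg_eq hη]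
  have h1 : w x = ∫ _ in (-(1 / 2) : ℝ)..(1 / 2), w x := by
    rw [intervalIntegral.integral_const]; norm_num
  have h2 : Continuous fun s => w (x + η * s) :=
    w.continuous.comp (continuous_const.add (continuous_const.mul continuous_id))
  rw [h1, ← intervalIntegral.integral_sub (h2.intervalIntegrable _ _)
    (continuous_const.intervalIntegrable _ _)]
  refine (intervalIntegral.norm_integral_le_of_norm_le_const (C := L * |η|) fun s hs => ?_).trans
    (by norm_num)
  refine (hw _ _).trans (mul_le_mul_of_nonneg_left ?_ hL)
  rw [Set.uIoc_of_le (by norm_num)] at hs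
  rw [add_sub_cancel_left, abs_mul]
  exact mul_le_of_le_one_right (abs_nonneg _) (abs_le.2 ⟨by linarith [hs.1], by linarith [hs.2]⟩)

/-- The commutator of averaging and multiplication by a Lipschitz function is `O(η)`. -/
theorem norm_commutator_le {w : ℝ →ᵇ ℝ} {L : ℝ} (hL : 0 ≤ L)
    (hw : ∀ x y, |w x - w y| ≤ L * |x - y|) {η : ℝ} (hη : η ≠ 0) (f : L2) :
    ‖mulOp w (avgOp η f) - avgOp η (mulOp w f)‖ ≤ L * |η| * ‖f‖ := by
  have hint : ∀ (g : L2) (x : ℝ), IntervalIntegrable (fun s => g (x + η * s)) volume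
      (-(1 / 2)) (1 / 2) := fun g x => by
    have h := (intervalIntegrable_L2 (Lp.memLp g) (x + η * (-(1 / 2))) (x + η * (1 / 2)))
    have h2 := (h.comp_add_left x).comp_mul_left (c := η)
    have e1 : (x + η * (-(1 / 2)) - x) / η = -(1 / 2) := by field_simp; ring
    have e2 : (x + η * (1 / 2) - x) / η = 1 / 2 := by field_simp; ring
    rwa [e1, e2] at h2
  have h1 : ‖mulOp w (avgOp η f) - avgOp η (mulOp w f)‖ ≤ L * |η| * ‖avgOp η |f|‖ := by
    refine Lp.norm_le_mul_norm_of_ae_le_mul ?_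
    filter_upwards [Lp.coeFn_sub (mulOp w (avgOp η f)) (avgOp η (mulOp w f)),
      mulOp_coeFn w (avgOp η f), avgOp_coeFn η f, avgOp_coeFn η (mulOp w f),
      avgOp_coeFn η |f|] with x e1 e2 e3 e4 e5
    rw [e1, Pi.sub_apply, e2, e3, e4, e5, avg_congr η (mulOp_coeFn w f),
      avg_congr η (Lp.coeFn_abs f), avg_eq hη, avg_eq hη, avg_eq hη]
    have hwc : Continuous fun s => w (x + η * s) :=
      w.continuous.comp (continuous_const.add (continuous_const.mul continuous_id))
    have e6 : w x * (∫ s in (-(1 / 2) : ℝ)..(1 / 2), f (x + η * s)) -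
        ∫ s in (-(1 / 2) : ℝ)..(1 / 2), w (x + η * s) * f (x + η * s)
        = ∫ s in (-(1 / 2) : ℝ)..(1 / 2), (w x - w (x + η * s)) * f (x + η * s) := by
      rw [← intervalIntegral.integral_const_mul, ← intervalIntegral.integral_sub
        ((hint f x).const_mul _) ((hint f x).continuousOn_mul hwc.continuousOn)]
      exact intervalIntegral.integral_congr fun s _ => by ring
    rw [e6]
    refine le_trans ?_ (mul_le_mul_of_nonneg_left (le_abs_self _) (by positivity))
    rw [← intervalIntegral.integral_const_mul]
    refine intervalIntegral.norm_integral_le_of_norm_le (by norm_num)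
      (ae_of_all _ fun s hs => ?_) ((hint f x).abs.const_mul _)
    rw [norm_mul, Real.norm_eq_abs (f _)]
    refine mul_le_mul_of_nonneg_right ((hw _ _).trans (mul_le_mul_of_nonneg_left ?_ hL))
      (abs_nonneg _)
    rw [sub_add_cancel_left, abs_neg, abs_mul]
    exact mul_le_of_le_one_right (abs_nonneg _) (abs_le.2 ⟨by linarith [hs.1], by linarith [hs.2]⟩)
  refine h1.trans (mul_le_mul_of_nonneg_left ((norm_avgOp_le _ _).trans (le_of_eq ?_))
    (by positivity))
  exact norm_abs_eq_norm f

/-- In the presence of the smoothing operator `(p - q ∂²)⁻¹`, two averages may be dropped. -/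
theorem norm_resolvent_avg_avg_sub_le {p q : ℝ} (hp : 0 < p) (hq : 0 < q) {η : ℝ} (hη : η ≠ 0)
    (f : L2) :
    ‖mulC (resolventSymbol p q hp hq) (fourierL2 (avgOp η (avgOp η f)))
      - mulC (resolventSymbol p q hp hq) (fourierL2 f)‖ ≤ 23 / (4 * q) * η ^ 2 * ‖f‖ := by
  rw [← fourierL2.norm_map f, fourierL2_avgOp hη, fourierL2_avgOp hη]
  set g := fourierL2 f
  refine Lp.norm_le_mul_norm_of_ae_le_mul ?_
  filter_upwards [Lp.coeFn_sub (mulC (resolventSymbol p q hp hq) (mulC (sincBCF η)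
      (mulC (sincBCF η) g))) (mulC (resolventSymbol p q hp hq) g),
    mulC_coeFn (resolventSymbol p q hp hq) (mulC (sincBCF η) (mulC (sincBCF η) g)),
    mulC_coeFn (sincBCF η) (mulC (sincBCF η) g), mulC_coeFn (sincBCF η) g,
    mulC_coeFn (resolventSymbol p q hp hq) g] with ξ e1 e2 e3 e4 e5
  rw [e1, Pi.sub_apply, e2, e3, e4, e5, sincBCF_apply, resolventSymbol_apply]
  have e6 : ((1 / (p + q * (2 * Real.pi * ξ) ^ 2) : ℝ) : ℂ) *
      ((Real.sinc (Real.pi * η * ξ) : ℂ) * ((Real.sinc (Real.pi * η * ξ) : ℂ) * g ξ))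
      - ((1 / (p + q * (2 * Real.pi * ξ) ^ 2) : ℝ) : ℂ) * g ξ
      = ((-(1 / (p + q * (2 * Real.pi * ξ) ^ 2) * (1 - Real.sinc (Real.pi * η * ξ) ^ 2)) : ℝ) : ℂ)
        * g ξ := by push_cast; ring
  rw [e6, norm_mul, Complex.norm_real, norm_neg]
  refine mul_le_mul_of_nonneg_right ?_ (norm_nonneg _)
  rw [Real.norm_of_nonneg (mul_nonneg (by positivity) (one_sub_sinc_sq_nonneg _)),
    one_div_mul_eq_div, div_le_iff₀ (by positivity)]
  refine (one_sub_sinc_sq_le _).trans ?_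
  have e7 : 23 / (4 * q) * η ^ 2 * (p + q * (2 * Real.pi * ξ) ^ 2)
      = 23 / (4 * q) * η ^ 2 * p + 23 * (Real.pi * η * ξ) ^ 2 := by field_simp; ring
  rw [e7]
  exact le_add_of_nonneg_left (by positivity)

/-- The averaged multiplication operator is close to the multiplication operator, in the
presence of the smoothing operator `(p - q ∂²)⁻¹`. -/
theorem norm_resolvent_avg_mul_avg_sub_le {p q : ℝ} (hp : 0 < p) (hq : 0 < q)
    {w : ℝ →ᵇ ℝ} {L : ℝ} (hL : 0 ≤ L) (hw : ∀ x y, |w x - w y| ≤ L * |x - y|) :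
    ∃ C, 0 ≤ C ∧ ∀ η : ℝ, η ≠ 0 → |η| ≤ 1 → ∀ f : L2,
      ‖mulC (resolventSymbol p q hp hq) (fourierL2 (avgOp η (mulOp (avgBCF η w) (avgOp η f))))
        - mulC (resolventSymbol p q hp hq) (fourierL2 (mulOp w f))‖ ≤ C * |η| * ‖f‖ := by
  refine ⟨‖resolventSymbol p q hp hq‖ * (2 * L) + 23 / (4 * q) * ‖w‖, by positivity,
    fun η hη hη1 f => ?_⟩
  set κ := resolventSymbol p q hp hq with hκ
  have h1 : ‖mulOp (avgBCF η w) (avgOp η f) - mulOp w (avgOp η f)‖ ≤ L * |η| * ‖f‖ := by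
    rw [← mulOp_sub]
    exact (norm_mulOp_le _ _).trans (mul_le_mul (norm_avgBCF_sub_le hL hw hη) (norm_avgOp_le _ _)
      (norm_nonneg _) (by positivity))
  have h2 := norm_commutator_le hL hw hη f
  have h3 := norm_resolvent_avg_avg_sub_le hp hq hη (mulOp w f)
  rw [← hκ] at h3
  have e : mulC κ (fourierL2 (avgOp η (mulOp (avgBCF η w) (avgOp η f))))
        - mulC κ (fourierL2 (mulOp w f))
      = mulC κ (fourierL2 (avgOp η ((mulOp (avgBCF η w) (avgOp η f) - mulOp w (avgOp η f))
          + (mulOp w (avgOp η f) - avgOp η (mulOp w f)))))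
        + (mulC κ (fourierL2 (avgOp η (avgOp η (mulOp w f))))
          - mulC κ (fourierL2 (mulOp w f))) := by
    simp only [map_add, map_sub]
    abel
  rw [e]
  refine (norm_add_le _ _).trans ?_
  have h4 : ‖mulC κ (fourierL2 (avgOp η ((mulOp (avgBCF η w) (avgOp η f) - mulOp w (avgOp η f))
      + (mulOp w (avgOp η f) - avgOp η (mulOp w f)))))‖ ≤ ‖κ‖ * (2 * (L * |η| * ‖f‖)) := by
    refine (norm_mulC_le _ _).trans (mul_le_mul_of_nonneg_left ?_ (norm_nonneg _))
    rw [fourierL2.norm_map]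
    refine (norm_avgOp_le _ _).trans ((norm_add_le _ _).trans ?_)
    linarith
  have h5 : 23 / (4 * q) * η ^ 2 * ‖mulOp w f‖ ≤ 23 / (4 * q) * |η| * (‖w‖ * ‖f‖) := by
    have h6 : η ^ 2 ≤ |η| := by rw [← sq_abs]; nlinarith [abs_nonneg η]
    have := norm_mulOp_le w f
    gcongr
  refine (add_le_add h4 (h3.trans h5)).trans (le_of_eq ?_)
  ring

/-! ### The uniform a priori estimate -/

/-- Pointwise bounds almost everywhere pass to the norms in `L²(ℝ; ℂ)`. -/
theorem norm_le_of_ae_le_add {f g₁ g₂ g₃ g₄ : L2C} {C ε : ℝ} (hC : 0 ≤ C) (hε : 0 ≤ ε)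
    (h : ∀ᵐ ξ, ‖f ξ‖ ≤ C * (‖g₁ ξ‖ + ‖g₂ ξ‖ + ‖g₃ ξ‖ + ε * ‖g₄ ξ‖)) :
    ‖f‖ ≤ C * (‖g₁‖ + ‖g₂‖ + ‖g₃‖ + ε * ‖g₄‖) := by
  let N : L2C → L2 := fun g => (Lp.memLp g).norm.toLp _
  have hN : ∀ g, N g =ᵐ[volume] fun ξ => ‖g ξ‖ := fun g => (Lp.memLp g).norm.coeFn_toLp
  have hNn : ∀ g, ‖N g‖ = ‖g‖ := fun g => by
    simp only [N]
    rw [Lp.norm_toLp, eLpNorm_norm, Lp.norm_def]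
  have h1 : ‖f‖ ≤ C * ‖N g₁ + N g₂ + N g₃ + ε • N g₄‖ := by
    refine Lp.norm_le_mul_norm_of_ae_le_mul ?_
    filter_upwards [h, hN g₁, hN g₂, hN g₃, hN g₄,
      Lp.coeFn_add (N g₁ + N g₂ + N g₃) (ε • N g₄), Lp.coeFn_add (N g₁ + N g₂) (N g₃),
      Lp.coeFn_add (N g₁) (N g₂), Lp.coeFn_smul ε (N g₄)] with ξ e e1 e2 e3 e4 e5 e6 e7 e8
    rw [e5, Pi.add_apply, e6, Pi.add_apply, e7, Pi.add_apply, e8, Pi.smul_apply, e1, e2, e3, e4,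
      smul_eq_mul, Real.norm_of_nonneg (by positivity)]
    exact e
  refine h1.trans (mul_le_mul_of_nonneg_left ?_ hC)
  refine (norm_add_le _ _).trans (add_le_add ((norm_add_le _ _).trans
    (add_le_add ((norm_add_le _ _).trans (add_le_add ?_ ?_)) ?_)) ?_)
  · rw [hNn]
  · rw [hNn]
  · rw [hNn]
  · rw [norm_smul, hNn, Real.norm_of_nonneg hε]

theorem norm_apply_le (V : L2Pair) (i : Fin 2) : ‖V i‖ ≤ ‖V‖ := PiLp.norm_apply_le V i

theorem norm_le_add (V : L2Pair) : ‖V‖ ≤ ‖V 0‖ + ‖V 1‖ := by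
  have h := PiLp.norm_sq_eq_of_L2 (fun _ : Fin 2 => L2) V
  rw [Fin.sum_univ_two] at h
  refine (sq_le_sq₀ (norm_nonneg _) (by positivity)).1 ?_
  rw [h]
  nlinarith [norm_nonneg (V 0), norm_nonneg (V 1), mul_nonneg (norm_nonneg (V 0)) (norm_nonneg (V 1))]

namespace Coeffs

variable {M : ℕ} (P : Coeffs M)

theorem kdvWave_apply (x : ℝ) : P.kdvWave x =
    3 * P.d₁ / (2 * P.d₂) * (1 / Real.cosh (1 / 2 * √P.d₁ * x)) ^ 2 := rfl

theorem exists_lipschitz_kdvWave :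
    ∃ L, 0 ≤ L ∧ ∀ x y, |P.kdvWave x - P.kdvWave y| ≤ L * |x - y| := by
  set c := 3 * P.d₁ / (2 * P.d₂) with hc
  set b := 1 / 2 * √P.d₁ with hb
  refine ⟨|c| * (2 * |b|), by positivity, fun x y => ?_⟩
  have hd : ∀ z, HasDerivAt P.kdvWave
      (c * (-(2 * b) * Real.sinh (b * z) / Real.cosh (b * z) ^ 3)) z := fun z => by
    have hz := (Real.cosh_pos (b * z)).ne'
    have h1 : HasDerivAt (fun z => Real.cosh (b * z)) (Real.sinh (b * z) * b) z :=
      ((hasDerivAt_id z).const_mul b).cosh.congr_deriv (by simp)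
    have h2 := (((h1.fun_inv hz).pow 2).const_mul c)
    have e : (P.kdvWave : ℝ → ℝ) = fun z => c * ((fun z => (Real.cosh (b * z))⁻¹) ^ 2) z := by
      funext z
      rw [kdvWave_apply, one_div]
      rfl
    rw [e]
    refine h2.congr_deriv ?_
    push_cast
    field_simp
  have h := Convex.norm_image_sub_le_of_norm_hasDerivWithin_le (f := P.kdvWave) (s := Set.univ)
    (C := |c| * (2 * |b|)) (fun z _ => (hd z).hasDerivWithinAt) (fun z _ => ?_) convex_univ
    (Set.mem_univ y) (Set.mem_univ x)
  · exact h
  · have hz := Real.one_le_cosh (b * z)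
    rw [norm_mul c, norm_div (-(2 * b) * _), norm_mul (-(2 * b)), norm_neg, norm_mul 2 b, Real.norm_two,
      Real.norm_eq_abs, Real.norm_eq_abs, Real.norm_eq_abs, norm_pow,
      Real.norm_of_nonneg (by positivity)]
    refine mul_le_mul_of_nonneg_left ?_ (abs_nonneg _)
    rw [div_le_iff₀ (by positivity)]
    refine mul_le_mul_of_nonneg_left ((abs_sinh_le_cosh _).trans ?_) (by positivity)
    calc Real.cosh (b * z) = Real.cosh (b * z) ^ 1 := (pow_one _).symm
      _ ≤ _ := pow_le_pow_right₀ hz (by norm_num)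

/-- The coefficients `∑_m η_{1,j}^m` of the potential in the limit operator. -/
noncomputable def limitCoeff (j : Fin 2) : ℝ := ∑ m, P.etaCoeff m 0 j

variable {P}

theorem limitCoeff_add (h : P.Generic) :
    P.limitCoeff 0 + P.lam * P.limitCoeff 1 = 2 * P.d₂ * P.dispersion := by
  have e : P.d₂ * P.dispersion = (P.a₃ + P.lam ^ 2 * P.a₄ + P.lam * P.a₅)
      + P.lam * (P.lam * P.b₅ + P.lam ^ 2 * P.b₃ + P.b₄) :=
    div_mul_cancel₀ _ h.dispersion_pos.ne'
  rw [mul_assoc, e]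
  simp only [limitCoeff, a₃, a₄, a₅, b₃, b₄, b₅, Finset.mul_sum, ← Finset.sum_add_distrib]
  refine Finset.sum_congr rfl fun m _ => ?_
  simp only [etaCoeff, Matrix.of_apply, Matrix.cons_val_zero, Matrix.cons_val_one]
  ring

theorem etaCoeff_eq_zero {m : Fin M} (hk : P.k m = 0) (i j : Fin 2) : P.etaCoeff m i j = 0 := by
  fin_cases i <;> fin_cases j <;> simp [etaCoeff, hk]

variable (P)

theorem norm_waveOp_le (η : ℝ) (f : L2) : ‖P.waveOp η f‖ ≤ ‖P.kdvWave‖ * ‖f‖ := by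
  refine (norm_avgOp_le _ _).trans ((norm_mulOp_le _ _).trans ?_)
  exact mul_le_mul (norm_avgBCF_le _ _) (norm_avgOp_le _ _) (norm_nonneg _) (norm_nonneg _)

theorem Mop_apply (ε : ℝ) (i j : Fin 2) (f : L2) : P.Mop ε i j f =
    (if i = 0 then 1 else ε ^ 2) • ∑ m, P.etaCoeff m i j • P.waveOp (P.k m * ε) f := by
  rw [Mop]
  simp only [smul_apply, sum_apply]

theorem norm_sum_waveOp_le (ε : ℝ) (i j : Fin 2) (f : L2) :
    ‖∑ m, P.etaCoeff m i j • P.waveOp (P.k m * ε) f‖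
      ≤ (∑ m, |P.etaCoeff m i j|) * ‖P.kdvWave‖ * ‖f‖ := by
  rw [mul_assoc, Finset.sum_mul]
  refine (norm_sum_le _ _).trans (Finset.sum_le_sum fun m _ => ?_)
  rw [norm_smul, Real.norm_eq_abs]
  exact mul_le_mul_of_nonneg_left (P.norm_waveOp_le _ _) (abs_nonneg _)

theorem exists_norm_Mop_le : ∃ C, 0 ≤ C ∧ ∀ (ε : ℝ) (V : L2Pair),
    ‖matOp (P.Mop ε) V 0‖ ≤ C * ‖V‖ ∧ ‖matOp (P.Mop ε) V 1‖ ≤ C * ε ^ 2 * ‖V‖ := by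
  have hrow : ∀ i (ε : ℝ) (V : L2Pair),
      ‖∑ j, ∑ m, P.etaCoeff m i j • P.waveOp (P.k m * ε) (V j)‖
        ≤ (∑ j, (∑ m, |P.etaCoeff m i j|) * ‖P.kdvWave‖) * ‖V‖ := fun i ε V => by
    rw [Finset.sum_mul]
    refine (norm_sum_le _ _).trans (Finset.sum_le_sum fun j _ => ?_)
    exact (P.norm_sum_waveOp_le _ _ _ _).trans
      (mul_le_mul_of_nonneg_left (norm_apply_le V j) (by positivity))
  refine ⟨∑ i, ∑ j, (∑ m, |P.etaCoeff m i j|) * ‖P.kdvWave‖, by positivity, fun ε V => ⟨?_, ?_⟩⟩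
  · rw [matOp_apply]
    simp only [Mop_apply, if_true, one_smul]
    refine (hrow 0 ε V).trans (mul_le_mul_of_nonneg_right ?_ (norm_nonneg _))
    rw [Fin.sum_univ_two (f := fun i => ∑ j, (∑ m, |P.etaCoeff m i j|) * ‖P.kdvWave‖)]
    exact le_add_of_nonneg_right (by positivity)
  · rw [matOp_apply]
    simp only [Mop_apply, one_ne_zero, if_false, ← Finset.smul_sum]
    rw [norm_smul, Real.norm_of_nonneg (sq_nonneg ε), mul_comm _ (ε ^ 2), mul_assoc]
    refine mul_le_mul_of_nonneg_left ((hrow 1 ε V).trans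
      (mul_le_mul_of_nonneg_right ?_ (norm_nonneg _))) (sq_nonneg _)
    rw [Fin.sum_univ_two (f := fun i => ∑ j, (∑ m, |P.etaCoeff m i j|) * ‖P.kdvWave‖)]
    exact le_add_of_nonneg_left (by positivity)

/-- The first row of `ℳ_ε` converges to a multiplication operator, in the presence of
`(p - q ∂²)⁻¹`. -/
theorem exists_resolvent_Mop_sub_le {p q : ℝ} (hp : 0 < p) (hq : 0 < q) :
    ∃ C, 0 ≤ C ∧ ∃ ε₁ > 0, ∀ ε : ℝ, 0 < ε → ε < ε₁ → ∀ V : L2Pair,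
      ‖mulC (resolventSymbol p q hp hq) (fourierL2 (matOp (P.Mop ε) V 0))
        - mulC (resolventSymbol p q hp hq) (fourierL2 (mulOp P.kdvWave
          (P.limitCoeff 0 • V 0 + P.limitCoeff 1 • V 1)))‖ ≤ C * ε * ‖V‖ := by
  obtain ⟨L, hL, hW⟩ := P.exists_lipschitz_kdvWave
  obtain ⟨C₀, hC₀, h₀⟩ := norm_resolvent_avg_mul_avg_sub_le hp hq hL hW
  set κ := resolventSymbol p q hp hq
  refine ⟨∑ j, ∑ m, |P.etaCoeff m 0 j| * (C₀ * |P.k m|), by positivity,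
    1 / (1 + ∑ m, |P.k m|), by positivity, fun ε hε hε₁ V => ?_⟩
  have hkε : ∀ m, |P.k m * ε| ≤ 1 := fun m => by
    have h1 : |P.k m| ≤ ∑ m, |P.k m| :=
      Finset.single_le_sum (f := fun m => |P.k m|) (fun _ _ => abs_nonneg _) (Finset.mem_univ m)
    rw [lt_div_iff₀ (by positivity)] at hε₁
    rw [abs_mul, abs_of_pos hε]
    nlinarith
  have e : mulC κ (fourierL2 (matOp (P.Mop ε) V 0)) - mulC κ (fourierL2 (mulOp P.kdvWave
      (P.limitCoeff 0 • V 0 + P.limitCoeff 1 • V 1)))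
      = ∑ j, ∑ m, P.etaCoeff m 0 j • (mulC κ (fourierL2 (P.waveOp (P.k m * ε) (V j)))
        - mulC κ (fourierL2 (mulOp P.kdvWave (V j)))) := by
    have e1 : P.limitCoeff 0 • V 0 + P.limitCoeff 1 • V 1 = ∑ j, P.limitCoeff j • V j :=
      (Fin.sum_univ_two fun j => P.limitCoeff j • V j).symm
    rw [e1, matOp_apply]
    simp only [Mop_apply, if_true, one_smul, limitCoeff, map_sum, map_smul, smul_sub,
      Finset.sum_sub_distrib, Finset.sum_smul]
  rw [e, Finset.sum_mul, Finset.sum_mul]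
  refine (norm_sum_le _ _).trans (Finset.sum_le_sum fun j _ => ?_)
  rw [Finset.sum_mul, Finset.sum_mul]
  refine (norm_sum_le _ _).trans (Finset.sum_le_sum fun m _ => ?_)
  rcases eq_or_ne (P.k m) 0 with hk | hk
  · rw [etaCoeff_eq_zero hk]
    simp
  · rw [norm_smul, Real.norm_eq_abs, mul_assoc, mul_assoc]
    refine mul_le_mul_of_nonneg_left ?_ (abs_nonneg _)
    refine (h₀ _ (mul_ne_zero hk hε.ne') (hkε m) (V j)).trans ?_
    rw [abs_mul, abs_of_pos hε]
    have := norm_apply_le V j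
    calc C₀ * (|P.k m| * ε) * ‖V j‖ ≤ C₀ * (|P.k m| * ε) * ‖V‖ := by gcongr
      _ = _ := by ring

theorem Lop_apply_zero (ε : ℝ) (V : L2Pair) : P.Lop ε V 0 =
    matOp (P.Bcan ε) V 0 + P.lam • matOp (P.Bcan ε) V 1 - matOp (P.Mop ε) V 0 := by
  simp only [Lop, matOp_apply, Fin.sum_univ_two, Matrix.sub_apply, B, Matrix.mul_apply,
    Matrix.map_apply, Tmat, sub_apply, add_apply, mul_apply_eq_comp, Algebra.algebraMap_eq_smul_one,
    smul_apply, one_apply_eq_self, Matrix.of_apply, Matrix.cons_val_zero, Matrix.cons_val_one,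
    one_smul, smul_add]
  abel

theorem Lop_apply_one (ε : ℝ) (V : L2Pair) : P.Lop ε V 1 =
    ε ^ 2 • matOp (P.Bcan ε) V 1 - matOp (P.Mop ε) V 1 := by
  simp only [Lop, matOp_apply, Fin.sum_univ_two, Matrix.sub_apply, B, Matrix.mul_apply,
    Matrix.map_apply, Tmat, sub_apply, add_apply, mul_apply_eq_comp, Algebra.algebraMap_eq_smul_one,
    smul_apply, one_apply_eq_self, Matrix.of_apply, Matrix.cons_val_zero, Matrix.cons_val_one,
    zero_smul, zero_apply, zero_add, smul_add]
  abel

end Coeffs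

/-! ### Inversion on the Fourier side -/

namespace Coeffs

variable {M : ℕ} {P : Coeffs M}

/-- On the Fourier side, `V` solves a `2 × 2` linear system, whence `V` is, up to small errors, the
multiple `(1 + λ² - a ∂²)⁻¹ (ℳ_ε V)₀` of `(1, λ)`. -/
theorem exists_fourier_approx (hs : P.Symmetric) (h : P.Generic) (hi : P.InversionCondition) :
    ∃ ε₀ > 0, ∃ C ≥ 0, ∀ ε : ℝ, 0 < ε → ε < ε₀ → ∀ V : L2Pair,
      ‖fourierL2 (V 0) - mulC (resolventSymbol (1 + P.lam ^ 2) P.dispersion (by positivity)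
          h.dispersion_pos) (fourierL2 (matOp (P.Mop ε) V 0))‖
        ≤ C * (‖P.Lop ε V‖ + ε * ‖V‖) ∧
      ‖fourierL2 (V 1) - P.lam • mulC (resolventSymbol (1 + P.lam ^ 2) P.dispersion (by positivity)
          h.dispersion_pos) (fourierL2 (matOp (P.Mop ε) V 0))‖
        ≤ C * (‖P.Lop ε V‖ + ε * ‖V‖) := by
  obtain ⟨A, δ₁, hA, hδ₁, hb⟩ := exists_symbol_bounds hs h hi
  obtain ⟨ε₀, hε₀, C, hC, hsym⟩ := symbol_estimate (lam := P.lam) h.σ₀_sub_c₃_pos h.dispersion_pos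
    hA hδ₁
  obtain ⟨D, hD, hM⟩ := P.exists_norm_Mop_le
  refine ⟨min 1 ε₀, by positivity, C * (2 + 2 * D), by positivity, fun ε hε hεlt V => ?_⟩
  have hε1 : ε ≤ 1 := (hεlt.trans_le (min_le_left _ _)).le
  have hεε₀ : ε < ε₀ := hεlt.trans_le (min_le_right _ _)
  set κ := resolventSymbol (1 + P.lam ^ 2) P.dispersion (by positivity) h.dispersion_pos with hκ
  set G := P.Lop ε V with hG
  set m₀ := matOp (P.Mop ε) V 0 with hm₀
  set m₁ := matOp (P.Mop ε) V 1 with hm₁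
  have hεC : (ε : ℂ) ≠ 0 := by exact_mod_cast hε.ne'
  -- the two rows of the equation
  have hrow : ∀ i, fourierL2 (matOp (P.Bcan ε) V i)
      = fourierL2 (P.Bcan ε i 0 (V 0)) + fourierL2 (P.Bcan ε i 1 (V 1)) := fun i => by
    rw [matOp_apply, Fin.sum_univ_two, map_add]
  have r₀ : fourierL2 (matOp (P.Bcan ε) V 0) + P.lam • fourierL2 (matOp (P.Bcan ε) V 1)
      = fourierL2 (G 0) + fourierL2 m₀ := by
    rw [← map_smul, ← map_add, ← map_add, hG, P.Lop_apply_zero, sub_add_cancel]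
  have r₁ : ε ^ 2 • fourierL2 (matOp (P.Bcan ε) V 1) = fourierL2 (G 1) + fourierL2 m₁ := by
    rw [← map_smul, ← map_add, hG, P.Lop_apply_one, sub_add_cancel]
  have hae : ∀ᵐ ξ, ‖(fourierL2 (V 0) - mulC κ (fourierL2 m₀) : L2C) ξ‖
        ≤ C * (‖fourierL2 (G 0) ξ‖ + ‖fourierL2 (G 1) ξ‖ + ‖fourierL2 m₁ ξ‖
          + ε * ‖fourierL2 m₀ ξ‖) ∧
      ‖(fourierL2 (V 1) - P.lam • mulC κ (fourierL2 m₀) : L2C) ξ‖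
        ≤ C * (‖fourierL2 (G 0) ξ‖ + ‖fourierL2 (G 1) ξ‖ + ‖fourierL2 m₁ ξ‖
          + ε * ‖fourierL2 m₀ ξ‖) := by
    have s₀ := hrow 0
    have s₁ := hrow 1
    set b₀ := fourierL2 (matOp (P.Bcan ε) V 0)
    set b₁ := fourierL2 (matOp (P.Bcan ε) V 1)
    have t₀ := Lp.coeFn_add b₀ (P.lam • b₁)
    rw [r₀] at t₀
    have t₁ := Lp.coeFn_smul (ε ^ 2) b₁
    rw [r₁] at t₁
    have u₀ := Lp.coeFn_add (fourierL2 (P.Bcan ε 0 0 (V 0))) (fourierL2 (P.Bcan ε 0 1 (V 1)))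
    rw [← s₀] at u₀
    have u₁ := Lp.coeFn_add (fourierL2 (P.Bcan ε 1 0 (V 0))) (fourierL2 (P.Bcan ε 1 1 (V 1)))
    rw [← s₁] at u₁
    filter_upwards [t₀, t₁, u₀, u₁, Lp.coeFn_smul P.lam b₁,
      Lp.coeFn_add (fourierL2 (G 0)) (fourierL2 m₀), Lp.coeFn_add (fourierL2 (G 1)) (fourierL2 m₁),
      P.fourierL2_Bcan hε.ne' 0 0 (V 0), P.fourierL2_Bcan hε.ne' 0 1 (V 1),
      P.fourierL2_Bcan hε.ne' 1 0 (V 0), P.fourierL2_Bcan hε.ne' 1 1 (V 1),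
      Lp.coeFn_sub (fourierL2 (V 0)) (mulC κ (fourierL2 m₀)),
      Lp.coeFn_sub (fourierL2 (V 1)) (P.lam • mulC κ (fourierL2 m₀)),
      Lp.coeFn_smul P.lam (mulC κ (fourierL2 m₀)), mulC_coeFn κ (fourierL2 m₀)]
      with ξ t₀ t₁ u₀ u₁ w₀ w₁ w₂ q₀₀ q₀₁ q₁₀ q₁₁ z₀ z₁ z₂ z₃
    set x := ε * (2 * Real.pi * ξ) with hx
    obtain ⟨p₁, p₂, p₃, p₄, p₅⟩ := hb x
    have hcan₀₀ : (if (0 : Fin 2) = 0 then P.σ ε else 0) - (∑ m, P.k m ^ 2 * P.α m 0 0)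
        + P.pert 0 0 x = ε ^ 2 + P.lam ^ 2 * (P.σ₀ - P.c₃) + P.pert 0 0 x := by
      rw [if_pos rfl, σ, ← h.σ₀_sub_c₁, c₁]; ring
    have hcan₀₁ : (if (0 : Fin 2) = 1 then P.σ ε else 0) - (∑ m, P.k m ^ 2 * P.α m 0 1)
        + P.pert 0 1 x = -(P.lam * (P.σ₀ - P.c₃)) + P.pert 0 1 x := by
      rw [if_neg (by decide), h.lam_mul, c₂]; ring
    have hcan₁₀ : (if (1 : Fin 2) = 0 then P.σ ε else 0) - (∑ m, P.k m ^ 2 * P.α m 1 0)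
        + P.pert 1 0 x = -(P.lam * (P.σ₀ - P.c₃)) + P.pert 0 1 x := by
      rw [if_neg (by decide), h.lam_mul, c₂]
      simp only [pert, hs.α_symm]
      ring
    have hcan₁₁ : (if (1 : Fin 2) = 1 then P.σ ε else 0) - (∑ m, P.k m ^ 2 * P.α m 1 1)
        + P.pert 1 1 x = ε ^ 2 + (P.σ₀ - P.c₃) + P.pert 1 1 x := by
      rw [if_pos rfl, σ, c₃]; ring
    rw [hcan₀₀] at q₀₀
    rw [hcan₀₁] at q₀₁
    rw [hcan₁₀] at q₁₀
    rw [hcan₁₁] at q₁₁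
    rw [w₁, Pi.add_apply, Pi.add_apply, u₀, w₀, Pi.smul_apply, u₁, Pi.add_apply, Pi.add_apply,
      Complex.real_smul, q₀₀, q₀₁, q₁₀, q₁₁] at t₀
    rw [w₂, Pi.add_apply, Pi.smul_apply, u₁, Pi.add_apply, Complex.real_smul, q₁₀, q₁₁] at t₁
    rw [z₀, z₁, Pi.sub_apply, Pi.sub_apply, z₂, Pi.smul_apply, z₃, Complex.real_smul]
    have hxe : x / ε = 2 * Real.pi * ξ := by rw [hx]; field_simp
    have hfin := hsym ε hε hεε₀ x (min |x| 2) (P.pert 0 0 x) (P.pert 0 1 x) (P.pert 1 1 x)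
      (le_min (abs_nonneg _) two_pos.le) (min_le_right _ _) (min_le_left _ _) p₁ p₂ p₃ p₄ p₅
      (fourierL2 (V 0) ξ) (fourierL2 (V 1) ξ) (fourierL2 (G 0) ξ) (fourierL2 (G 1) ξ)
      (fourierL2 m₀ ξ) (fourierL2 m₁ ξ) (by
        rw [t₀]
        push_cast
        field_simp) (by
        rw [t₁]
        push_cast
        field_simp)
    rw [hxe] at hfin
    exact hfin
  have hbound : C * (‖fourierL2 (G 0)‖ + ‖fourierL2 (G 1)‖ + ‖fourierL2 m₁‖ + ε * ‖fourierL2 m₀‖)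
      ≤ C * (2 + 2 * D) * (‖G‖ + ε * ‖V‖) := by
    simp only [fourierL2.norm_map]
    have h1 := norm_apply_le G 0
    have h2 := norm_apply_le G 1
    obtain ⟨h3, h4⟩ := hM ε V
    have h5 : D * ε ^ 2 * ‖V‖ ≤ D * (ε * ‖V‖) := by
      have : ε ^ 2 ≤ ε := by nlinarith
      calc D * ε ^ 2 * ‖V‖ ≤ D * ε * ‖V‖ := by gcongr
        _ = _ := by ring
    have h6 := mul_le_mul_of_nonneg_left h3 hε.le
    rw [mul_assoc]
    refine mul_le_mul_of_nonneg_left ?_ hC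
    have h7 : 0 ≤ D * ‖G‖ := by positivity
    have h8 : 0 ≤ ε * ‖V‖ := by positivity
    linarith
  exact ⟨(norm_le_of_ae_le_add hC hε.le (hae.mono fun _ h => h.1)).trans hbound,
    (norm_le_of_ae_le_add hC hε.le (hae.mono fun _ h => h.2)).trans hbound⟩

/-- The uniform a priori estimate on even functions. -/
theorem exists_norm_le_Lop (hs : P.Symmetric) (h : P.Generic) (hi : P.InversionCondition) :
    ∃ ε₀ > 0, ∃ C ≥ 0, ∀ ε : ℝ, 0 < ε → ε < ε₀ → ∀ V ∈ evenL2Pair, ‖V‖ ≤ C * ‖P.Lop ε V‖ := by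
  have ha := h.dispersion_pos
  have hp : 0 < 1 + P.lam ^ 2 := by positivity
  have hd := h.d₁_pos
  set κ := resolventSymbol (1 + P.lam ^ 2) P.dispersion hp ha with hκ
  set N₀ := P.limitCoeff 0
  set N₁ := P.limitCoeff 1
  have hN : N₀ + P.lam * N₁ = 2 * P.d₂ * P.dispersion := limitCoeff_add h
  set N := N₀ + P.lam * N₁ with hNdef
  obtain ⟨ε₁, hε₁, C₁, hC₁, h₁⟩ := exists_fourier_approx hs h hi
  obtain ⟨C₂, hC₂, ε₂, hε₂, h₂⟩ := P.exists_resolvent_Mop_sub_le hp ha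
  obtain ⟨C₃, hC₃, h₃⟩ := linearized_kdv_estimate (s := √P.d₁ / 2) hp ha (by positivity)
    (w := N • P.kdvWave) (by
      rw [← h.d₁_mul, div_pow, Real.sq_sqrt hd.le]; ring) (fun x => by
      have hd2 := h.d₂_ne
      have hc : Real.cosh (√P.d₁ / 2 * x) ≠ 0 := (Real.cosh_pos _).ne'
      have e : 1 / 2 * √P.d₁ * x = √P.d₁ / 2 * x := by ring
      rw [BoundedContinuousFunction.smul_apply, kdvWave_apply, hN, e, smul_eq_mul, div_pow √P.d₁,
        Real.sq_sqrt hd.le]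
      field_simp
      ring)
  set W := P.kdvWave
  -- `‖F_j‖ ≤ C₄ (‖G‖ + ε ‖V‖)` for the remainders `F_j`, and `‖u‖ ≤ C₅ (‖G‖ + ε ‖V‖)`
  set C₄ := C₁ + (1 + |P.lam|) * C₂ with hC₄
  set C₅ := C₃ * (|N₀| * C₄ + |N₁| * C₄) with hC₅
  set C₆ := 2 * C₄ + (1 + |P.lam|) * (‖κ‖ * (‖W‖ * C₅)) with hC₆
  have hC₄0 : 0 ≤ C₄ := by positivity
  have hC₅0 : 0 ≤ C₅ := by positivity
  have hC₆0 : 0 ≤ C₆ := by positivity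
  refine ⟨min (min ε₁ ε₂) (1 / (2 * C₆ + 1)), by positivity, 2 * C₆, by positivity,
    fun ε hε hεlt V hV => ?_⟩
  have hεε₁ : ε < ε₁ := hεlt.trans_le ((min_le_left _ _).trans (min_le_left _ _))
  have hεε₂ : ε < ε₂ := hεlt.trans_le ((min_le_left _ _).trans (min_le_right _ _))
  have hε6 : ε * (2 * C₆ + 1) ≤ 1 := by
    have := (hεlt.trans_le (min_le_right _ _)).le
    rwa [le_div_iff₀ (by positivity)] at this
  obtain ⟨a₀, a₁⟩ := h₁ ε hε hεε₁ V
  have a₂ := h₂ ε hε hεε₂ V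
  rw [← hκ] at a₀ a₁ a₂
  set u : L2 := N₀ • V 0 + N₁ • V 1 with hu
  set R := ‖P.Lop ε V‖ + ε * ‖V‖ with hR
  have hR0 : 0 ≤ R := by positivity
  have hεV : ε * ‖V‖ ≤ R := le_add_of_nonneg_left (norm_nonneg _)
  set m := mulC κ (fourierL2 (matOp (P.Mop ε) V 0))
  set y := mulC κ (fourierL2 (mulOp W u)) with hy
  have a₂' : ‖m - y‖ ≤ C₂ * R := by
    refine a₂.trans ?_
    rw [mul_assoc]
    exact mul_le_mul_of_nonneg_left hεV hC₂
  have b₀ : ‖fourierL2 (V 0) - y‖ ≤ C₄ * R := by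
    have e : fourierL2 (V 0) - y = (fourierL2 (V 0) - m) + (m - y) := by abel
    rw [e]
    refine (norm_add_le _ _).trans ((add_le_add a₀ a₂').trans ?_)
    have : 0 ≤ |P.lam| * C₂ * R := by positivity
    rw [hC₄]
    linarith
  have b₁ : ‖fourierL2 (V 1) - P.lam • y‖ ≤ C₄ * R := by
    have e : fourierL2 (V 1) - P.lam • y
        = (fourierL2 (V 1) - P.lam • m) + P.lam • (m - y) := by rw [smul_sub]; abel
    rw [e]
    refine (norm_add_le _ _).trans ?_
    rw [norm_smul, Real.norm_eq_abs]
    refine (add_le_add a₁ (mul_le_mul_of_nonneg_left a₂' (abs_nonneg _))).trans ?_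
    have : 0 ≤ C₂ * R := by positivity
    rw [hC₄]
    linarith
  have hueven : u ∈ evenL2 := evenL2.add_mem (evenL2.smul_mem _ (hV 0)) (evenL2.smul_mem _ (hV 1))
  have hub : ‖u‖ ≤ C₅ * R := by
    have e : fourierL2 u - mulC κ (fourierL2 (mulOp (N • W) u))
        = N₀ • (fourierL2 (V 0) - y) + N₁ • (fourierL2 (V 1) - P.lam • y) := by
      rw [mulOp_smul, map_smul, map_smul, ← hy, hu, map_add, map_smul, map_smul, hNdef]
      module
    have h4 := h₃ u hueven
    rw [e] at h4
    refine h4.trans ?_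
    rw [hC₅, mul_assoc]
    refine mul_le_mul_of_nonneg_left ((norm_add_le _ _).trans ?_) hC₃
    rw [norm_smul, norm_smul, Real.norm_eq_abs, Real.norm_eq_abs, add_mul, mul_assoc, mul_assoc]
    exact add_le_add (mul_le_mul_of_nonneg_left b₀ (abs_nonneg _))
      (mul_le_mul_of_nonneg_left b₁ (abs_nonneg _))
  have hyb : ‖y‖ ≤ ‖κ‖ * (‖W‖ * C₅) * R := by
    refine (norm_mulC_le _ _).trans ?_
    rw [fourierL2.norm_map, mul_assoc, mul_assoc]
    refine mul_le_mul_of_nonneg_left ((norm_mulOp_le _ _).trans ?_) (norm_nonneg _)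
    exact mul_le_mul_of_nonneg_left hub (norm_nonneg _)
  have c₀ : ‖V 0‖ ≤ C₄ * R + ‖y‖ := by
    rw [← fourierL2.norm_map (V 0)]
    have e : fourierL2 (V 0) = (fourierL2 (V 0) - y) + y := by abel
    rw [e]
    exact (norm_add_le _ _).trans (add_le_add_left b₀ _)
  have c₁ : ‖V 1‖ ≤ C₄ * R + |P.lam| * ‖y‖ := by
    rw [← fourierL2.norm_map (V 1)]
    have e : fourierL2 (V 1) = (fourierL2 (V 1) - P.lam • y) + P.lam • y := by abel
    rw [e]
    refine (norm_add_le _ _).trans (add_le_add b₁ (le_of_eq ?_))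
    rw [norm_smul, Real.norm_eq_abs]
  have hVR : ‖V‖ ≤ C₆ * R := by
    refine (norm_le_add V).trans ((add_le_add c₀ c₁).trans ?_)
    have := mul_le_mul_of_nonneg_left hyb (by positivity : 0 ≤ 1 + |P.lam|)
    rw [hC₆]
    linarith
  have hV0 := norm_nonneg V
  have hf : C₆ * (ε * ‖V‖) ≤ 1 / 2 * ‖V‖ := by
    rw [← mul_assoc]
    refine mul_le_mul_of_nonneg_right ?_ hV0
    linarith
  rw [hR, mul_add] at hVR
  linarith

end Coeffs

/-! ### Symmetry and invertibility -/

theorem inner_mulC_left (b : ℝ →ᵇ ℝ) (f g : L2C) :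
    inner ℝ (mulC b f) g = inner ℝ f (mulC b g) := by
  rw [L2.inner_def, L2.inner_def]
  refine integral_congr_ae ?_
  filter_upwards [mulC_coeFn b f, mulC_coeFn b g] with x h1 h2
  rw [h1, h2, ← Complex.real_smul, ← Complex.real_smul, real_inner_smul_left,
    real_inner_smul_right]

theorem inner_mulOp_left (w : ℝ →ᵇ ℝ) (f g : L2) :
    inner ℝ (mulOp w f) g = inner ℝ f (mulOp w g) := by
  rw [L2.inner_def, L2.inner_def]
  refine integral_congr_ae ?_
  filter_upwards [mulOp_coeFn w f, mulOp_coeFn w g] with x h1 h2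
  rw [h1, h2, ← smul_eq_mul, ← smul_eq_mul, real_inner_smul_left, real_inner_smul_right]

theorem inner_avgOp_left (η : ℝ) (f g : L2) :
    inner ℝ (avgOp η f) g = inner ℝ f (avgOp η g) := by
  rcases eq_or_ne η 0 with rfl | hη
  · simp [avgOp_zero]
  · rw [← fourierL2.inner_map_map, ← fourierL2.inner_map_map f, fourierL2_avgOp hη,
      fourierL2_avgOp hη, inner_mulC_left]

theorem isClosed_evenL2Pair : IsClosed (evenL2Pair : Set L2Pair) := by
  have : (evenL2Pair : Set L2Pair) = ⋂ i, (fun V : L2Pair => V i) ⁻¹' (evenL2 : Set L2) := by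
    ext V
    simp [mem_evenL2Pair]
  rw [this]
  exact isClosed_iInter fun i =>
    isClosed_evenL2.preimage (PiLp.proj (𝕜 := ℝ) 2 (fun _ : Fin 2 => L2) i).continuous

namespace Coeffs

variable {M : ℕ} (P : Coeffs M)

/-- The coefficients of the linearization of the nonlinearity before multiplication by `𝒯_ε`. -/
noncomputable def canCoeff (m : Fin M) : Matrix (Fin 2) (Fin 2) ℝ :=
  !![P.k m ^ 3 * (P.β₁₁ m 0 + P.lam * P.β₁₂ m 0), P.k m ^ 3 * (P.lam * P.β₂₂ m 0 + P.β₁₂ m 0);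
     P.k m ^ 3 * (P.lam * P.β₁₂ m 1 + P.β₁₁ m 1), P.k m ^ 3 * (P.lam * P.β₂₂ m 1 + P.β₁₂ m 1)]

/-- The symmetric operator matrix `𝒯_ε⁻¹ ℒ_ε`. -/
noncomputable def canOp (ε : ℝ) : Matrix (Fin 2) (Fin 2) (L2 →L[ℝ] L2) := fun i j =>
  P.Bcan ε i j - ∑ m, P.canCoeff m i j • P.waveOp (P.k m * ε)

theorem Lop_apply_zero_eq (ε : ℝ) (V : L2Pair) :
    P.Lop ε V 0 = matOp (P.canOp ε) V 0 + P.lam • matOp (P.canOp ε) V 1 := by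
  rw [Lop_apply_zero]
  have h : ∀ m j, P.etaCoeff m 0 j = P.canCoeff m 0 j + P.lam * P.canCoeff m 1 j := fun m j => by
    fin_cases j <;> simp [etaCoeff, canCoeff] <;> ring
  simp only [matOp_apply, Fin.sum_univ_two, Mop_apply, if_true, one_smul, canOp, sub_apply,
    sum_apply, smul_apply, h, add_smul, mul_smul, Finset.sum_add_distrib, ← Finset.smul_sum]
  module

theorem Lop_apply_one_eq (ε : ℝ) (V : L2Pair) :
    P.Lop ε V 1 = ε ^ 2 • matOp (P.canOp ε) V 1 := by
  rw [Lop_apply_one]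
  have h : ∀ m j, P.etaCoeff m 1 j = P.canCoeff m 1 j := fun m j => by
    fin_cases j <;> rfl
  simp only [matOp_apply, Fin.sum_univ_two, Mop_apply, one_ne_zero, if_false, canOp, sub_apply,
    sum_apply, smul_apply, h]
  module

theorem inner_canOp_left (ε : ℝ) (i j : Fin 2) (f g : L2) :
    inner ℝ (P.canOp ε i j f) g = inner ℝ f (P.canOp ε i j g) := by
  simp only [canOp, Bcan, waveOp, sub_apply, sum_apply, smul_apply, mul_apply_eq_comp,
    one_apply_eq_self, sq (avgOp _), inner_sub_left, inner_sub_right, sum_inner, inner_sum,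
    real_inner_smul_left, real_inner_smul_right, inner_avgOp_left, inner_mulOp_left]

variable {P}

theorem canOp_symm (hs : P.Symmetric) (ε : ℝ) (i j : Fin 2) : P.canOp ε i j = P.canOp ε j i := by
  have hα : ∀ m, P.α m i j = P.α m j i := fun m => by
    fin_cases i <;> fin_cases j <;> simp [hs.α_symm]
  have hc : ∀ m, P.canCoeff m i j = P.canCoeff m j i := fun m => by
    fin_cases i <;> fin_cases j <;> simp [canCoeff, hs.β_symm₁, hs.β_symm₂]
  simp only [canOp, Bcan, hα, hc, eq_comm (a := i) (b := j)]

theorem inner_matOp_canOp_left (hs : P.Symmetric) (ε : ℝ) (V U : L2Pair) :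
    inner ℝ (matOp (P.canOp ε) V) U = inner ℝ V (matOp (P.canOp ε) U) := by
  simp only [PiLp.inner_apply, matOp_apply, sum_inner, inner_sum, inner_canOp_left]
  rw [Finset.sum_comm]
  exact Finset.sum_congr rfl fun i _ => Finset.sum_congr rfl fun j _ => by rw [canOp_symm hs]

theorem matOp_canOp_mem {ε : ℝ} (hε : ε ≠ 0) {V : L2Pair} (hV : V ∈ evenL2Pair) :
    matOp (P.canOp ε) V ∈ evenL2Pair := by
  have h := P.Lop_mem ε V hV
  have h1 : matOp (P.canOp ε) V 1 ∈ evenL2 := by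
    have := evenL2.smul_mem (ε ^ 2)⁻¹ (h 1)
    rwa [Lop_apply_one_eq, smul_smul, inv_mul_cancel₀ (pow_ne_zero 2 hε), one_smul] at this
  have h0 : matOp (P.canOp ε) V 0 ∈ evenL2 := by
    have := evenL2.sub_mem (h 0) (evenL2.smul_mem P.lam h1)
    rwa [Lop_apply_zero_eq, add_sub_cancel_right] at this
  intro i
  fin_cases i
  · exact h0
  · exact h1

/-- If `ℒ_ε` is injective on even functions, its range there is dense: a function orthogonal to the
range is mapped by the transpose of `𝒯_ε` to the kernel of the symmetric operator
`𝒯_ε⁻¹ ℒ_ε`. -/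
theorem eq_zero_of_orthogonal_range (hs : P.Symmetric) {ε : ℝ} (hε : ε ≠ 0)
    (hinj : ∀ V ∈ evenL2Pair, P.Lop ε V = 0 → V = 0) {U : L2Pair} (hU : U ∈ evenL2Pair)
    (horth : ∀ V ∈ evenL2Pair, inner ℝ (P.Lop ε V) U = 0) : U = 0 := by
  set U' : L2Pair := WithLp.toLp 2 ![U 0, P.lam • U 0 + ε ^ 2 • U 1] with hU'
  have hU'0 : U' 0 = U 0 := rfl
  have hU'1 : U' 1 = P.lam • U 0 + ε ^ 2 • U 1 := rfl
  have hmem : U' ∈ evenL2Pair := by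
    intro i
    fin_cases i
    · exact hU 0
    · exact evenL2.add_mem (evenL2.smul_mem _ (hU 0)) (evenL2.smul_mem _ (hU 1))
  have htr : ∀ V, inner ℝ (P.Lop ε V) U = inner ℝ V (matOp (P.canOp ε) U') := fun V => by
    rw [← inner_matOp_canOp_left hs, PiLp.inner_apply, PiLp.inner_apply, Fin.sum_univ_two,
      Fin.sum_univ_two, hU'0, hU'1, Lop_apply_zero_eq, Lop_apply_one_eq, inner_add_left,
      inner_add_right, real_inner_smul_left, real_inner_smul_left, real_inner_smul_right,
      real_inner_smul_right]
    ring
  have hX : matOp (P.canOp ε) U' = 0 := by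
    have h := horth _ (matOp_canOp_mem (P := P) hε hmem)
    rwa [htr, inner_self_eq_zero] at h
  have hU'z : U' = 0 := by
    refine hinj U' hmem (PiLp.ext fun i => ?_)
    fin_cases i
    · change P.Lop ε U' 0 = 0
      rw [Lop_apply_zero_eq, hX]
      simp
    · change P.Lop ε U' 1 = 0
      rw [Lop_apply_one_eq, hX]
      simp
  have h0 : U 0 = 0 := by rw [← hU'0, hU'z]; rfl
  have h1 : U 1 = 0 := by
    have h2 : U' 1 = 0 := by rw [hU'z]; rfl
    rw [hU'1, h0, smul_zero, zero_add] at h2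
    exact (smul_eq_zero.1 h2).resolve_left (pow_ne_zero 2 hε)
  refine PiLp.ext fun i => ?_
  fin_cases i
  · exact h0
  · exact h1

end Coeffs

end LatticeWave

theorem mainTheorem2 {M : ℕ} (P : LatticeWave.Coeffs M)
    (hsymm : P.Symmetric) (hgen : P.Generic) (hinv : P.InversionCondition) :
    ∃ εs : ℝ, 0 < εs ∧ ∃ C : ℝ, ∀ ε ∈ Set.Ioo (0 : ℝ) εs,
      ∃ R : LatticeWave.evenL2Pair →L[ℝ] LatticeWave.evenL2Pair,
        R ∘L P.LopEven ε = ContinuousLinearMap.id ℝ LatticeWave.evenL2Pair ∧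
        P.LopEven ε ∘L R = ContinuousLinearMap.id ℝ LatticeWave.evenL2Pair ∧
        ∀ G : LatticeWave.evenL2Pair, ‖R G‖ ≤ C * ‖G‖ := by
  obtain ⟨ε₀, hε₀, C, hC, hest⟩ := LatticeWave.Coeffs.exists_norm_le_Lop hsymm hgen hinv
  refine ⟨ε₀, hε₀, C, fun ε hε => ?_⟩
  have : CompleteSpace LatticeWave.evenL2Pair :=
    LatticeWave.isClosed_evenL2Pair.completeSpace_coe
  set T := P.LopEven ε with hT
  have hbound : ∀ V, ‖V‖ ≤ C * ‖T V‖ := fun V => hest ε hε.1 hε.2 V V.2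
  have hanti : AntilipschitzWith ⟨C, hC⟩ T := T.antilipschitz_of_bound hbound
  have hker : T.ker = ⊥ := LinearMap.ker_eq_bot.2 hanti.injective
  have hclosed : IsClosed (T.range : Set LatticeWave.evenL2Pair) :=
    hanti.isClosed_range T.uniformContinuous
  have hrange : T.range = ⊤ := by
    have : CompleteSpace T.range := hclosed.completeSpace_coe
    rw [← Submodule.orthogonal_eq_bot_iff, Submodule.eq_bot_iff]
    intro U hU
    refine Subtype.ext (LatticeWave.Coeffs.eq_zero_of_orthogonal_range hsymm hε.1.ne' ?_ U.2 ?_)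
    · intro V hV hV0
      have h := hest ε hε.1 hε.2 V hV
      rw [hV0, norm_zero, mul_zero] at h
      exact norm_le_zero_iff.1 h
    · intro V hV
      exact (Submodule.mem_orthogonal _ _).1 hU (T ⟨V, hV⟩) ⟨_, rfl⟩
  let e := ContinuousLinearEquiv.ofBijective T hker hrange
  have he : ∀ V, e V = T V := fun _ => rfl
  refine ⟨e.symm, ?_, ?_, fun G => ?_⟩
  · ext1 V
    exact e.symm_apply_apply V
  · ext1 V
    exact e.apply_symm_apply V
  · refine (hbound _).trans (le_of_eq ?_)
    rw [← he]
    exact congrArg (fun z => C * ‖z‖) (e.apply_symm_apply G)
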